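/- Let $b\in(0,3)$ and write $Gf=\tfrac12 e^{-|\cdot|}*f=(1-\partial_x^2)^{-1}f$ for functions $f$ on $\mathbb R$. Let $u\in C([0,\infty):H^2(\mathbb R))$ be a real-valued global (weak) solution of the $b$-family equation $$\partial_t u+\partial_x\Big(\tfrac12u^2+G\big(\tfrac b2u^2+\tfrac{3-b}2(\partial_xu)^2\big)\Big)=0,$$ and put $m_0=u(0,\cdot)-\partial_x^2u(0,\cdot)$. Assume that $m_0\in L^1(\mathbb R)$. (i) If $m_0\ge 0$ almost everywhere, then there exists $\sigma>0$ such that, for every $p\in[1,\infty]$, $$\lim_{t\to\infty}\|u(t)\|_{W^{1,p}((\sigma t,\infty))}=0.$$ (ii) If $m_0\le 0$ almost everywhere, then there exists $\sigma>0$ such that, for every $p\in[1,\infty]$, $$\lim_{t\to\infty}\|u(t)\|_{W^{1,p}((-\infty,-\sigma t))}=0.$$ -/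

import Mathlib

open Set Filter Topology MeasureTheory
open scoped ENNReal ContDiff

noncomputable section

/-- `g` is a weak (distributional) derivative of `f` on the open set `U ⊆ ℝ`. -/
structure HasWeakDerivOn (U : Set ℝ) (f g : ℝ → ℝ) : Prop where
  locallyIntegrable_left : LocallyIntegrableOn f U
  locallyIntegrable_right : LocallyIntegrableOn g U
  integral_eq : ∀ φ : ℝ → ℝ, ContDiff ℝ ∞ φ → HasCompactSupport φ → tsupport φ ⊆ U →
    ∫ x, f x * deriv φ x = - ∫ x, g x * φ x

/-- The norm of `W^{1,p}(U)`, namely `‖f‖_{L^p(U)} + ‖f'‖_{L^p(U)}`, where `f'` is the weak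
derivative of `f` on `U`. Weak derivatives are unique up to null sets, so the infimum is only a way
to select one; the value is `∞` if `f` has no weak derivative on `U` or is not in `W^{1,p}(U)`. -/
def eW1pNorm (p : ℝ≥0∞) (U : Set ℝ) (f : ℝ → ℝ) : ℝ≥0∞ :=
  ⨅ (g : ℝ → ℝ) (_ : HasWeakDerivOn U f g),
    (eLpNorm f p (volume.restrict U) + eLpNorm g p (volume.restrict U))

theorem HasWeakDerivOn.congr_ae {f g f' g' : ℝ → ℝ} (h : HasWeakDerivOn univ f g)
    (hf : f =ᵐ[volume] f') (hg : g =ᵐ[volume] g') : HasWeakDerivOn univ f' g' where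
  locallyIntegrable_left := locallyIntegrableOn_univ.2
    ((locallyIntegrableOn_univ.1 h.locallyIntegrable_left).congr hf)
  locallyIntegrable_right := locallyIntegrableOn_univ.2
    ((locallyIntegrableOn_univ.1 h.locallyIntegrable_right).congr hg)
  integral_eq φ h1 h2 h3 := by
    have e1 : ∫ x, f' x * deriv φ x = ∫ x, f x * deriv φ x :=
      integral_congr_ae (hf.mono fun x hx => by simp [hx])
    have e2 : ∫ x, g' x * φ x = ∫ x, g x * φ x :=
      integral_congr_ae (hg.mono fun x hx => by simp [hx])
    rw [e1, e2]
    exact h.integral_eq φ h1 h2 h3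

theorem integrable_mul_of_test {f φ : ℝ → ℝ} (hf : LocallyIntegrableOn f univ)
    (hφ : Continuous φ) (hc : HasCompactSupport φ) : Integrable (fun x => f x * φ x) := by
  simpa [mul_comm] using
    (locallyIntegrableOn_univ.1 hf).integrable_smul_left_of_hasCompactSupport hφ hc

theorem HasWeakDerivOn.add {f g f' g' : ℝ → ℝ} (h : HasWeakDerivOn univ f g)
    (h' : HasWeakDerivOn univ f' g') : HasWeakDerivOn univ (f + f') (g + g') where
  locallyIntegrable_left := h.locallyIntegrable_left.add h'.locallyIntegrable_left
  locallyIntegrable_right := h.locallyIntegrable_right.add h'.locallyIntegrable_right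
  integral_eq φ h1 h2 h3 := by
    have hd : Continuous (deriv φ) := h1.continuous_deriv (by simp)
    simp only [Pi.add_apply, add_mul]
    rw [integral_add (integrable_mul_of_test h.locallyIntegrable_left hd h2.deriv)
        (integrable_mul_of_test h'.locallyIntegrable_left hd h2.deriv),
      integral_add (integrable_mul_of_test h.locallyIntegrable_right h1.continuous h2)
        (integrable_mul_of_test h'.locallyIntegrable_right h1.continuous h2),
      h.integral_eq φ h1 h2 h3, h'.integral_eq φ h1 h2 h3]
    ring

theorem HasWeakDerivOn.const_smul {f g : ℝ → ℝ} (c : ℝ) (h : HasWeakDerivOn univ f g) :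
    HasWeakDerivOn univ (c • f) (c • g) where
  locallyIntegrable_left := locallyIntegrableOn_univ.2
    ((locallyIntegrableOn_univ.1 h.locallyIntegrable_left).smul c)
  locallyIntegrable_right := locallyIntegrableOn_univ.2
    ((locallyIntegrableOn_univ.1 h.locallyIntegrable_right).smul c)
  integral_eq φ h1 h2 h3 := by
    simp only [Pi.smul_apply, smul_eq_mul, mul_assoc, integral_const_mul]
    rw [h.integral_eq φ h1 h2 h3]
    ring

theorem hasWeakDerivOn_zero : HasWeakDerivOn univ 0 0 where
  locallyIntegrable_left := locallyIntegrableOn_univ.2 locallyIntegrable_zero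
  locallyIntegrable_right := locallyIntegrableOn_univ.2 locallyIntegrable_zero
  integral_eq φ _ _ _ := by simp

/-- The Sobolev space `H²(ℝ)` of real functions: a function in `L²` is stored with its first two
weak derivatives, also in `L²`. As a subspace of the `ℓ²`-sum of three copies of `L²(ℝ)`, it carries
the usual norm `(‖v‖² + ‖v'‖² + ‖v''‖²)^{1/2}`. -/
def H2 : Submodule ℝ (PiLp 2 (fun _ : Fin 3 => Lp ℝ 2 (volume : Measure ℝ))) where
  carrier := {w | HasWeakDerivOn univ (w 0) (w 1) ∧ HasWeakDerivOn univ (w 1) (w 2)}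
  add_mem' := by
    rintro v w ⟨h1, h2⟩ ⟨h3, h4⟩
    exact ⟨(h1.add h3).congr_ae (Lp.coeFn_add _ _).symm (Lp.coeFn_add _ _).symm,
      (h2.add h4).congr_ae (Lp.coeFn_add _ _).symm (Lp.coeFn_add _ _).symm⟩
  zero_mem' := ⟨hasWeakDerivOn_zero.congr_ae (Lp.coeFn_zero _ _ _).symm (Lp.coeFn_zero _ _ _).symm,
    hasWeakDerivOn_zero.congr_ae (Lp.coeFn_zero _ _ _).symm (Lp.coeFn_zero _ _ _).symm⟩
  smul_mem' := by
    rintro c v ⟨h1, h2⟩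
    exact ⟨(h1.const_smul c).congr_ae (Lp.coeFn_smul _ _).symm (Lp.coeFn_smul _ _).symm,
      (h2.const_smul c).congr_ae (Lp.coeFn_smul _ _).symm (Lp.coeFn_smul _ _).symm⟩

namespace H2

/-- The function `v` itself (a representative of the `L²` class). -/
def fn (v : H2) : ℝ → ℝ := v.1 0

/-- The first weak derivative `v_x`. -/
def dx (v : H2) : ℝ → ℝ := v.1 1

/-- The second weak derivative `v_xx`. -/
def dxx (v : H2) : ℝ → ℝ := v.1 2

/-- The momentum `m = v - v_xx`. -/
def momentum (v : H2) : ℝ → ℝ := fun x => H2.fn v x - H2.dxx v x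

end H2

/-- The operator `G = (1 - ∂_x²)⁻¹`, that is, `G f = ½ e^{-|·|} * f`. -/
def greenOp (f : ℝ → ℝ) (x : ℝ) : ℝ := ∫ y, (1 / 2) * Real.exp (-|x - y|) * f y

/-- The flux `½ v² + G(b/2 v² + (3-b)/2 v_x²)` of the `b`-family. -/
def bFamilyFlux (b : ℝ) (v : H2) (x : ℝ) : ℝ :=
  (1 / 2) * H2.fn v x ^ 2 +
    greenOp (fun y => b / 2 * H2.fn v y ^ 2 + (3 - b) / 2 * H2.dx v y ^ 2) x

/-- `u ∈ C([0,∞) : H²(ℝ))` is a global solution of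
`∂_t u + ∂_x (½ u² + G(b/2 u² + (3-b)/2 u_x²)) = 0`, in the weak sense: the equation is tested
against smooth compactly supported functions of `x` and integrated over `[0,t]`. -/
structure IsGlobalSolution (b : ℝ) (u : ℝ → H2) : Prop where
  continuousOn : ContinuousOn u (Ici 0)
  weak_eq : ∀ ψ : ℝ → ℝ, ContDiff ℝ ∞ ψ → HasCompactSupport ψ → ∀ t : ℝ, 0 ≤ t →
    ∫ x, H2.fn (u t) x * ψ x =
      (∫ x, H2.fn (u 0) x * ψ x) + ∫ s in (0 : ℝ)..t, ∫ x, bFamilyFlux b (u s) x * deriv ψ x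

end

noncomputable section

/-! ### Weak derivatives on the line -/

/-! The momentum `m = u - u_xx` formally satisfies `m_t + (u m)_x + (b-1) u_x m = 0`, so its sign is
preserved along characteristics. If `m ≥ 0`, then factoring `1 - ∂_x² = (1 - ∂_x)(1 + ∂_x)` gives
`|u_x| ≤ u`. This inequality carries the rest: it makes `u` nonnegative, and it makes `e^x u`
increasing and `e^{-x} u` decreasing, so that `e^{-|x-y|} u(y) ≤ u(x)`. With `L` a bound for the
mass, `u ≤ L` and the source is at most `3/2 u²`, whence the flux is at most `(5/4) L u`
(`flux_le`).

A flux bounded by `c u` means that mass travels to the right with speed at most `c`: the mass beyond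
`y + c t` at time `t` is at most the initial mass beyond `y` (`integral_Ioi_le`). Taking `y = c t`,
the mass beyond `2 c t` is at most a tail of the integrable function `u(0)`, which tends to zero.
Since `|u_x| ≤ u`, the same tail bounds the supremum of `u` there, and interpolation between `L¹`
and `L^∞` gives every `p`. Part (ii) follows from the symmetry `(x,u) ↦ (-x,-u)`.

The delicate point is the sign of `m`, since `u_xx` is only in `L²` and the momentum equation has no
pointwise meaning. It is replaced by a balance for `∫ m` between two characteristics, which involves
only `u` and `u_x`. When `u_x` is frozen at the left endpoint, this becomes a linear ODE with an
error term. The sum of the errors over a partition vanishes as the mesh tends to zero, because `u_x`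
is Hölder continuous with exponent 1/2 (`neg_le_momentumIntegral`). -/

theorem exists_support_subset_Ioo {φ : ℝ → ℝ} (hφ : HasCompactSupport φ) :
    ∃ R : ℝ, 0 < R ∧ tsupport φ ⊆ Ioo (-R) R := by
  obtain ⟨R, hR, h⟩ := hφ.isCompact.isBounded.subset_ball_lt 0 0
  exact ⟨R, hR, h.trans (by simp [Real.ball_eq_Ioo])⟩

theorem integral_eq_intervalIntegral_of_support {f : ℝ → ℝ} {R : ℝ}
    (h : Function.support f ⊆ Ioo (-R) R) : ∫ x, f x = ∫ x in (-R)..R, f x :=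
  (intervalIntegral.integral_eq_integral_of_support_subset
    (h.trans Ioo_subset_Ioc_self)).symm

theorem MeasureTheory.LocallyIntegrable.intervalIntegrable' {f : ℝ → ℝ}
    (hf : LocallyIntegrable f volume) (a b : ℝ) : IntervalIntegrable f volume a b :=
  intervalIntegrable_iff.mpr <|
    (hf.integrableOn_isCompact isCompact_uIcc).mono_set uIoc_subset_uIcc

theorem MeasureTheory.LocallyIntegrable.continuous_primitive {f : ℝ → ℝ}
    (hf : LocallyIntegrable f volume) (a : ℝ) : Continuous (fun x => ∫ t in a..x, f t) :=
  intervalIntegral.continuous_primitive (fun a b => hf.intervalIntegrable' a b) a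

/-- A primitive is absolutely continuous, so it can be integrated by parts against a test function;
by Lebesgue differentiation its derivative is `g` almost everywhere. -/
theorem hasWeakDerivOn_primitive {g : ℝ → ℝ} (hg : LocallyIntegrable g volume) :
    HasWeakDerivOn univ (fun x => ∫ t in (0 : ℝ)..x, g t) g where
  locallyIntegrable_left :=
    locallyIntegrableOn_univ.2 (hg.continuous_primitive 0).locallyIntegrable
  locallyIntegrable_right := locallyIntegrableOn_univ.2 hg
  integral_eq φ h1 h2 _ := by
    obtain ⟨R, hR, hs⟩ := exists_support_subset_Ioo h2
    have hs' : Function.support φ ⊆ Ioo (-R) R := (subset_tsupport φ).trans hs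
    have hd : Function.support (deriv φ) ⊆ Ioo (-R) R := (support_deriv_subset).trans hs
    have hz : ∀ x, x ∉ Ioo (-R) R → φ x = 0 := fun x hx => by
      by_contra h
      exact hx (hs' h)
    rw [integral_eq_intervalIntegral_of_support (R := R)
        ((Function.support_mul_subset_right _ _).trans hd),
      integral_eq_intervalIntegral_of_support (R := R)
        ((Function.support_mul_subset_right _ _).trans hs')]
    have hG := (hg.intervalIntegrable' (-R) R).absolutelyContinuousOnInterval_intervalIntegral
      (c := 0) (by rw [uIcc_of_le (by linarith)]; constructor <;> linarith)
    have hφ : AbsolutelyContinuousOnInterval φ (-R) R :=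
      (h1.of_le (by simp)).contDiffOn.absolutelyContinuousOnInterval
    rw [hG.integral_mul_deriv_eq_deriv_mul hφ, hz R (by simp), hz (-R) (by simp)]
    simp only [mul_zero, sub_zero, zero_sub, neg_inj]
    apply intervalIntegral.integral_congr_ae
    filter_upwards [_root_.LocallyIntegrable.ae_hasDerivAt_integral hg] with x hx _
    rw [(hx 0).deriv]

/-- The du Bois-Reymond argument: a test function of mean zero is the derivative of a test function,
so `f` annihilates it. Subtracting a multiple of a fixed bump `ρ` of integral one brings any test
function to mean zero, and identifies the constant as `∫ f ρ`. -/
theorem exists_ae_eq_const_of_weakDeriv_zero {f : ℝ → ℝ} (h : HasWeakDerivOn univ f 0) :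
    ∃ c : ℝ, f =ᵐ[volume] fun _ => c := by
  have hf := locallyIntegrableOn_univ.1 h.locallyIntegrable_left
  let B : ContDiffBump (0 : ℝ) := ⟨1, 2, by norm_num, by norm_num⟩
  let ρ : ℝ → ℝ := B.normed volume
  have hρ : ContDiff ℝ ∞ ρ := B.contDiff_normed
  have hρc : HasCompactSupport ρ := B.hasCompactSupport_normed
  have hρ1 : ∫ x, ρ x = 1 := B.integral_normed
  refine ⟨∫ x, f x * ρ x, ?_⟩
  refine ae_eq_of_integral_contDiff_smul_eq hf continuous_const.locallyIntegrable ?_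
  intro χ h1 h2
  set I := ∫ x, χ x with hI
  let θ : ℝ → ℝ := fun x => χ x - I * ρ x
  have hθ : ContDiff ℝ ∞ θ := h1.sub (contDiff_const.mul hρ)
  have hθc : HasCompactSupport θ := h2.sub (hρc.mul_left)
  obtain ⟨R, hR, hs⟩ := exists_support_subset_Ioo hθc
  have hs' : Function.support θ ⊆ Ioo (-R) R := (subset_tsupport θ).trans hs
  have hz : ∀ x, x ∉ Ioo (-R) R → θ x = 0 := fun x hx => by
    by_contra h
    exact hx (hs' h)
  have hθ0 : ∫ x in (-R)..R, θ x = 0 := by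
    rw [← integral_eq_intervalIntegral_of_support hs']
    simp only [θ]
    rw [integral_sub (h1.continuous.integrable_of_hasCompactSupport h2)
      ((hρ.continuous.integrable_of_hasCompactSupport hρc).const_mul _), integral_const_mul, hρ1]
    simp [hI]
  let Θ : ℝ → ℝ := fun x => ∫ t in (-R)..x, θ t
  have hΘd : ∀ x, HasDerivAt Θ (θ x) x := fun x =>
    (hθ.continuous.integral_hasStrictDerivAt (-R) x).hasDerivAt
  have hΘ' : deriv Θ = θ := funext fun x => (hΘd x).deriv
  have hΘ : ContDiff ℝ ∞ Θ := by
    rw [contDiff_infty_iff_deriv]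
    exact ⟨fun x => (hΘd x).differentiableAt, by rw [hΘ']; exact hθ⟩
  have hΘc : HasCompactSupport Θ := by
    refine HasCompactSupport.intro (isCompact_Icc (a := -R) (b := R)) fun x hx => ?_
    simp only [mem_Icc, not_and_or, not_le] at hx
    rcases hx with hx | hx
    · refine intervalIntegral.integral_zero_ae (Eventually.of_forall fun y hy => hz y ?_)
      rw [uIoc_of_ge hx.le] at hy
      exact fun h => absurd h.1 (not_lt.2 hy.2)
    · have : ∫ t in R..x, θ t = 0 := by
        refine intervalIntegral.integral_zero_ae (Eventually.of_forall fun y hy => hz y ?_)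
        rw [uIoc_of_le hx.le] at hy
        exact fun h => absurd h.2 (not_lt.2 hy.1.le)
      simp only [Θ]
      rw [← intervalIntegral.integral_add_adjacent_intervals
        (hθ.continuous.intervalIntegrable (-R) R) (hθ.continuous.intervalIntegrable R x),
        hθ0, this, add_zero]
  have key := h.integral_eq Θ hΘ hΘc (subset_univ _)
  rw [hΘ'] at key
  simp only [Pi.zero_apply, zero_mul, integral_zero, neg_zero, θ, mul_sub] at key
  have i1 := integrable_mul_of_test h.locallyIntegrable_left h1.continuous h2
  have i2 := (integrable_mul_of_test h.locallyIntegrable_left hρ.continuous hρc).const_mul I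
  have e : ∀ x, f x * χ x - f x * (I * ρ x) = f x * χ x - I * (f x * ρ x) := fun x => by ring
  simp only [e] at key
  rw [integral_sub i1 i2, integral_const_mul] at key
  simp only [smul_eq_mul]
  rw [integral_mul_const, ← hI]
  simp only [mul_comm (χ _)]
  linarith

theorem HasWeakDerivOn.exists_ae_eq_primitive {f g : ℝ → ℝ} (h : HasWeakDerivOn univ f g) :
    ∃ c : ℝ, f =ᵐ[volume] fun x => c + ∫ t in (0 : ℝ)..x, g t := by
  have hg := locallyIntegrableOn_univ.1 h.locallyIntegrable_right
  have h' := h.add ((hasWeakDerivOn_primitive hg).const_smul (-1))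
  have e : g + (-1 : ℝ) • g = 0 := by ext; simp
  rw [e] at h'
  obtain ⟨c, hc⟩ := exists_ae_eq_const_of_weakDeriv_zero h'
  refine ⟨c, hc.mono fun x hx => ?_⟩
  simp only [Pi.add_apply, Pi.smul_apply, smul_eq_mul] at hx
  linarith

theorem HasWeakDerivOn.mono {U V : Set ℝ} {f g : ℝ → ℝ} (h : HasWeakDerivOn V f g)
    (hUV : U ⊆ V) : HasWeakDerivOn U f g where
  locallyIntegrable_left := h.locallyIntegrable_left.mono_set hUV
  locallyIntegrable_right := h.locallyIntegrable_right.mono_set hUV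
  integral_eq φ h1 h2 h3 := h.integral_eq φ h1 h2 (h3.trans hUV)

/-! ### The Green operator on bounded continuous functions -/

/-- `∫_{-∞}^x e^{-(x-y)} h(y) dy`, the left half of `2 G h`. -/
def expLeft (h : ℝ → ℝ) (x : ℝ) : ℝ := ∫ z in Ioi (0 : ℝ), Real.exp (-z) * h (x - z)

/-- `∫_x^∞ e^{x-y} h(y) dy`, the right half of `2 G h`. -/
def expRight (h : ℝ → ℝ) (x : ℝ) : ℝ := ∫ z in Ioi (0 : ℝ), Real.exp (-z) * h (x + z)

/-- The derivative of `G h`. -/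
def greenOpDeriv (h : ℝ → ℝ) (x : ℝ) : ℝ := (1 / 2) * (expRight h x - expLeft h x)

theorem integrableOn_exp_neg_Ioi_zero : IntegrableOn (fun z : ℝ => Real.exp (-z)) (Ioi 0) :=
  integrableOn_exp_neg_Ioi 0

theorem integrable_exp_neg_abs : Integrable (fun z : ℝ => Real.exp (-|z|)) := by
  rw [← integrableOn_univ, ← Iic_union_Ioi (a := (0 : ℝ))]
  refine IntegrableOn.union ?_ ?_
  · refine (integrableOn_exp_Iic 0).congr_fun (fun z hz => ?_) measurableSet_Iic
    simp [abs_of_nonpos (mem_Iic.1 hz)]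
  · refine integrableOn_exp_neg_Ioi_zero.congr_fun (fun z hz => ?_) measurableSet_Ioi
    simp [abs_of_pos (mem_Ioi.1 hz)]

theorem integrable_exp_neg_abs_mul {h : ℝ → ℝ} {K : ℝ} (hc : AEStronglyMeasurable h volume)
    (hK : ∀ x, |h x| ≤ K) (x : ℝ) : Integrable (fun z => Real.exp (-|z|) * h (x - z)) := by
  refine (integrable_exp_neg_abs.mul_const K).mono' ?_ (Eventually.of_forall fun z => ?_)
  · exact (by fun_prop : Continuous fun z : ℝ => Real.exp (-|z|)).aestronglyMeasurable.mul
      (hc.comp_measurePreserving (volume.measurePreserving_sub_left x))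
  · rw [norm_mul, Real.norm_of_nonneg (Real.exp_pos _).le]
    exact mul_le_mul_of_nonneg_left (hK _) (Real.exp_pos _).le

theorem greenOp_eq_integral_sub (h : ℝ → ℝ) (x : ℝ) :
    greenOp h x = (1 / 2) * ∫ z, Real.exp (-|z|) * h (x - z) := by
  unfold greenOp
  rw [← integral_const_mul,
    ← integral_sub_left_eq_self (fun y => (1 / 2) * Real.exp (-|x - y|) * h y) volume x]
  simp [mul_assoc]

/-- Splitting the kernel at its kink leaves two halves, each of which solves a first-order linear
ODE. This yields the derivatives of `G h` without differentiating `e^{-|x|}`. -/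
theorem greenOp_eq_expLeft_add_expRight {h : ℝ → ℝ} {K : ℝ} (hc : Continuous h)
    (hK : ∀ x, |h x| ≤ K) (x : ℝ) : greenOp h x = (1 / 2) * (expLeft h x + expRight h x) := by
  have hi := integrable_exp_neg_abs_mul hc.aestronglyMeasurable hK x
  rw [greenOp_eq_integral_sub,
    ← intervalIntegral.integral_Iic_add_Ioi (b := 0) hi.integrableOn hi.integrableOn, add_comm]
  congr 2
  · refine setIntegral_congr_fun measurableSet_Ioi fun z hz => ?_
    simp [abs_of_pos (mem_Ioi.1 hz)]
  · unfold expRight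
    have := integral_comp_neg_Ioi (0 : ℝ) (fun z => Real.exp (-|z|) * h (x - z))
    rw [neg_zero] at this
    rw [← this]
    refine setIntegral_congr_fun measurableSet_Ioi fun z hz => ?_
    simp [abs_of_pos (mem_Ioi.1 hz)]

theorem expRight_eq_expLeft_comp_neg (h : ℝ → ℝ) (x : ℝ) :
    expRight h x = expLeft (fun y => h (-y)) (-x) := by
  simp [expRight, expLeft, add_comm]

/-- The domain of integration does not depend on the point, so dominated convergence gives
continuity in time and space together. -/
theorem continuous_expLeft {h : ℝ → ℝ → ℝ} {K : ℝ} (hc : Continuous (Function.uncurry h))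
    (hK : ∀ t x, |h t x| ≤ K) : Continuous (fun p : ℝ × ℝ => expLeft (h p.1) p.2) := by
  refine continuous_of_dominated (bound := fun z => Real.exp (-z) * K) (fun p => ?_)
    (fun p => Eventually.of_forall fun z => ?_) (integrableOn_exp_neg_Ioi_zero.mul_const K)
    (Eventually.of_forall fun z => ?_)
  · have : Continuous fun z : ℝ => Real.exp (-z) * Function.uncurry h (p.1, p.2 - z) := by fun_prop
    exact this.aestronglyMeasurable
  · rw [norm_mul, Real.norm_of_nonneg (Real.exp_pos _).le]
    exact mul_le_mul_of_nonneg_left (hK _ _) (Real.exp_pos _).le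
  · have : Continuous fun p : ℝ × ℝ => Real.exp (-z) * Function.uncurry h (p.1, p.2 - z) := by
      fun_prop
    exact this

theorem continuous_expRight {h : ℝ → ℝ → ℝ} {K : ℝ} (hc : Continuous (Function.uncurry h))
    (hK : ∀ t x, |h t x| ≤ K) : Continuous (fun p : ℝ × ℝ => expRight (h p.1) p.2) := by
  have hc' : Continuous (Function.uncurry fun t y => h t (-y)) :=
    hc.comp (continuous_fst.prodMk continuous_snd.neg)
  have := (continuous_expLeft hc' fun t x => hK t (-x)).comp
    (continuous_fst.prodMk continuous_snd.neg)
  simp only [expRight_eq_expLeft_comp_neg]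
  exact this

theorem hasDerivAt_expLeft {h : ℝ → ℝ} {K : ℝ} (hc : Continuous h) (hK : ∀ x, |h x| ≤ K) (x : ℝ) :
    HasDerivAt (expLeft h) (h x - expLeft h x) x := by
  have hi : ∀ a, IntegrableOn (fun y => Real.exp y * h y) (Iic a) := fun a => by
    refine ((integrableOn_exp_Iic a).mul_const K).mono' ?_ (Eventually.of_forall fun y => ?_)
    · exact (by fun_prop : Continuous fun y => Real.exp y * h y).aestronglyMeasurable
    · rw [norm_mul, Real.norm_of_nonneg (Real.exp_pos _).le]
      exact mul_le_mul_of_nonneg_left (hK _) (Real.exp_pos _).le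
  -- The substitution `y = x - z` moves the dependence on `x` into a factor `e^{-x}` and an
  -- endpoint, where the fundamental theorem of calculus applies.
  have e : expLeft h = fun x => Real.exp (-x) *
      ((∫ y in Iic (0 : ℝ), Real.exp y * h y) + ∫ y in (0 : ℝ)..x, Real.exp y * h y) := by
    funext x
    rw [← intervalIntegral.integral_Iic_sub_Iic (hi 0) (hi x), add_sub_cancel,
      ← integral_const_mul, ← setIntegral_congr_set Iio_ae_eq_Iic]
    rw [← (volume.measurePreserving_sub_left x).setIntegral_preimage_emb
      (Homeomorph.subLeft x).measurableEmbedding]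
    simp only [preimage_const_sub_Iio, sub_self, expLeft]
    refine setIntegral_congr_fun measurableSet_Ioi fun z _ => ?_
    simp only [← mul_assoc, ← Real.exp_add]
    ring_nf
  have hd : HasDerivAt (fun x => ∫ y in (0 : ℝ)..x, Real.exp y * h y) (Real.exp x * h x) x :=
    ((by fun_prop : Continuous fun y => Real.exp y * h y).integral_hasStrictDerivAt 0 x).hasDerivAt
  have hE : HasDerivAt (fun x : ℝ => Real.exp (-x)) (-Real.exp (-x)) x := by
    simpa using (hasDerivAt_neg x).exp
  have := hE.mul (hd.const_add (∫ y in Iic (0 : ℝ), Real.exp y * h y))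
  rw [e]
  refine this.congr_deriv ?_
  have : Real.exp (-x) * (Real.exp x * h x) = h x := by
    rw [← mul_assoc, ← Real.exp_add]; simp
  rw [this]
  ring

theorem hasDerivAt_expRight {h : ℝ → ℝ} {K : ℝ} (hc : Continuous h) (hK : ∀ x, |h x| ≤ K)
    (x : ℝ) : HasDerivAt (expRight h) (expRight h x - h x) x := by
  have := (hasDerivAt_expLeft (h := fun y => h (-y)) (by fun_prop) (fun x => hK (-x)) (-x)).comp x
    (hasDerivAt_neg x)
  refine (this.congr_deriv ?_).congr_of_eventuallyEq
    (Eventually.of_forall fun y => expRight_eq_expLeft_comp_neg h y)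
  rw [expRight_eq_expLeft_comp_neg h x, neg_neg]
  ring

theorem hasDerivAt_greenOp {h : ℝ → ℝ} {K : ℝ} (hc : Continuous h) (hK : ∀ x, |h x| ≤ K)
    (x : ℝ) : HasDerivAt (greenOp h) (greenOpDeriv h x) x := by
  have := ((hasDerivAt_expLeft hc hK x).add (hasDerivAt_expRight hc hK x)).const_mul (1 / 2)
  refine (this.congr_deriv ?_).congr_of_eventuallyEq
    (Eventually.of_forall fun y => greenOp_eq_expLeft_add_expRight hc hK y)
  unfold greenOpDeriv
  ring

theorem hasDerivAt_greenOpDeriv {h : ℝ → ℝ} {K : ℝ} (hc : Continuous h) (hK : ∀ x, |h x| ≤ K)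
    (x : ℝ) : HasDerivAt (greenOpDeriv h) (greenOp h x - h x) x := by
  have := ((hasDerivAt_expRight hc hK x).sub (hasDerivAt_expLeft hc hK x)).const_mul (1 / 2)
  refine this.congr_deriv ?_
  rw [greenOp_eq_expLeft_add_expRight hc hK]
  ring

theorem continuous_greenOp {h : ℝ → ℝ → ℝ} {K : ℝ} (hc : Continuous (Function.uncurry h))
    (hK : ∀ t x, |h t x| ≤ K) : Continuous (fun p : ℝ × ℝ => greenOp (h p.1) p.2) := by
  have e : (fun p : ℝ × ℝ => greenOp (h p.1) p.2) =
      fun p => (1 / 2) * (expLeft (h p.1) p.2 + expRight (h p.1) p.2) := funext fun p =>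
    greenOp_eq_expLeft_add_expRight (hc.comp (continuous_const.prodMk continuous_id)) (hK p.1) p.2
  rw [e]
  exact continuous_const.mul ((continuous_expLeft hc hK).add (continuous_expRight hc hK))

theorem continuous_greenOpDeriv {h : ℝ → ℝ → ℝ} {K : ℝ} (hc : Continuous (Function.uncurry h))
    (hK : ∀ t x, |h t x| ≤ K) : Continuous (fun p : ℝ × ℝ => greenOpDeriv (h p.1) p.2) :=
  continuous_const.mul ((continuous_expRight hc hK).sub (continuous_expLeft hc hK))

theorem integral_exp_neg_abs : ∫ z : ℝ, Real.exp (-|z|) = 2 := by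
  have hi := integrable_exp_neg_abs
  have h1 : ∫ z in Iic (0 : ℝ), Real.exp (-|z|) = 1 := by
    rw [← integral_exp_Iic_zero]
    refine setIntegral_congr_fun measurableSet_Iic fun z hz => ?_
    simp [abs_of_nonpos (mem_Iic.1 hz)]
  have h2 : ∫ z in Ioi (0 : ℝ), Real.exp (-|z|) = 1 := by
    rw [← integral_exp_neg_Ioi_zero]
    refine setIntegral_congr_fun measurableSet_Ioi fun z hz => ?_
    simp [abs_of_pos (mem_Ioi.1 hz)]
  rw [← intervalIntegral.integral_Iic_add_Ioi (b := 0) hi.integrableOn hi.integrableOn, h1, h2]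
  norm_num

theorem abs_greenOp_le {h : ℝ → ℝ} {K : ℝ} (hK : ∀ x, |h x| ≤ K) (x : ℝ) :
    |greenOp h x| ≤ K := by
  rw [greenOp_eq_integral_sub, abs_mul, abs_of_pos (by norm_num : (0 : ℝ) < 1 / 2)]
  have : ‖∫ z, Real.exp (-|z|) * h (x - z)‖ ≤ ∫ z, Real.exp (-|z|) * K :=
    norm_integral_le_of_norm_le (integrable_exp_neg_abs.mul_const K)
      (Eventually.of_forall fun z => by
        rw [norm_mul, Real.norm_of_nonneg (Real.exp_pos _).le]
        exact mul_le_mul_of_nonneg_left (hK _) (Real.exp_pos _).le)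
  rw [integral_mul_const, integral_exp_neg_abs] at this
  rw [Real.norm_eq_abs] at this
  linarith

theorem abs_expLeft_le {h : ℝ → ℝ} {K : ℝ} (hK : ∀ x, |h x| ≤ K) (x : ℝ) :
    |expLeft h x| ≤ K := by
  have : ‖expLeft h x‖ ≤ ∫ z in Ioi (0 : ℝ), Real.exp (-z) * K :=
    norm_integral_le_of_norm_le (integrableOn_exp_neg_Ioi_zero.mul_const K)
      (Eventually.of_forall fun z => by
        rw [norm_mul, Real.norm_of_nonneg (Real.exp_pos _).le]
        exact mul_le_mul_of_nonneg_left (hK _) (Real.exp_pos _).le)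
  rwa [integral_mul_const, integral_exp_neg_Ioi_zero, one_mul, Real.norm_eq_abs] at this

theorem abs_greenOpDeriv_le {h : ℝ → ℝ} {K : ℝ} (hK : ∀ x, |h x| ≤ K) (x : ℝ) :
    |greenOpDeriv h x| ≤ K := by
  have h1 := abs_le.1 (abs_expLeft_le hK x)
  have h2 := abs_le.1 (abs_expLeft_le (h := fun y => h (-y)) (fun y => hK (-y)) (-x))
  rw [← expRight_eq_expLeft_comp_neg] at h2
  unfold greenOpDeriv
  rw [abs_le]
  constructor <;> linarith [h1.1, h1.2, h2.1, h2.2]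

theorem greenOp_nonneg {h : ℝ → ℝ} (hh : ∀ x, 0 ≤ h x) (x : ℝ) : 0 ≤ greenOp h x :=
  integral_nonneg fun y => mul_nonneg (mul_nonneg (by norm_num) (Real.exp_pos _).le) (hh y)

theorem greenOp_comp_neg (h : ℝ → ℝ) (x : ℝ) :
    greenOp (fun y => h (-y)) x = greenOp h (-x) := by
  unfold greenOp
  rw [← integral_neg_eq_self (fun y => 1 / 2 * Real.exp (-|x - y|) * h (-y))]
  congr 1
  ext y
  rw [neg_neg, sub_neg_eq_add, ← abs_neg, neg_add', sub_eq_add_neg]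

/-! ### Classical solutions -/

/-- The function `b/2 u² + (3-b)/2 u_x²`, with `v` in the place of `u_x`. -/
def source (b : ℝ) (u v : ℝ → ℝ) (y : ℝ) : ℝ := b / 2 * u y ^ 2 + (3 - b) / 2 * v y ^ 2

/-- The flux `½ u² + G(b/2 u² + (3-b)/2 u_x²)`, with `v` in the place of `u_x`. -/
def flux (b : ℝ) (u v : ℝ → ℝ) (x : ℝ) : ℝ := 1 / 2 * u x ^ 2 + greenOp (source b u v) x

/-- The space derivative of the flux. -/
def fluxDeriv (b : ℝ) (u v : ℝ → ℝ) (x : ℝ) : ℝ := u x * v x + greenOpDeriv (source b u v) x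

/-- `u` is a solution of the `b`-family on `[0,T]` with continuous space derivative `v`; the equation
is required as a conservation law on intervals. The function `w` stands for `u_xx`. -/
structure IsClassicalSolution (b T : ℝ) (u v w : ℝ → ℝ → ℝ) : Prop where
  continuous_left : Continuous (Function.uncurry u)
  continuous_right : Continuous (Function.uncurry v)
  hasDerivAt : ∀ t x, HasDerivAt (u t) (v t x) x
  exists_bound : ∃ K, 0 ≤ K ∧ ∀ t x, |u t x| ≤ K ∧ |v t x| ≤ K
  integrable_sq : ∀ t, Integrable (fun x => w t x ^ 2)
  exists_integral_sq_le : ∃ K, ∀ t, ∫ x, w t x ^ 2 ≤ K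
  sub_sq_le : ∀ t x y, x ≤ y → (v t y - v t x) ^ 2 ≤ (y - x) * ∫ z in x..y, w t z ^ 2
  conservation : ∀ t ∈ Icc 0 T, ∀ x y, (∫ z in x..y, u t z) - ∫ z in x..y, u 0 z =
    ∫ s in (0 : ℝ)..t, (flux b (u s) (v s) x - flux b (u s) (v s) y)

/-- A chain rule along a curve. Writing `f s (q s) = f t (q s) + ∫ τ in t..s, ft τ (q s)`, the first
term needs only the space derivative at time `t`, and the second only joint continuity of `ft`. -/
theorem hasDerivWithinAt_comp_of_partial {T t q' : ℝ} {f ft fx : ℝ → ℝ → ℝ} {q : ℝ → ℝ}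
    (hf : ∀ s ∈ Icc 0 T, ∀ t ∈ Icc 0 T, ∀ x, f t x - f s x = ∫ τ in s..t, ft τ x)
    (hft : Continuous (Function.uncurry ft)) (hfx : ∀ t x, HasDerivAt (f t) (fx t x) x)
    (ht : t ∈ Icc 0 T) (hq : HasDerivWithinAt q q' (Icc 0 T) t) :
    HasDerivWithinAt (fun s => f s (q s)) (fx t (q t) * q' + ft t (q t)) (Icc 0 T) t := by
  have h1 : HasDerivWithinAt (fun s => f t (q s)) (fx t (q t) * q') (Icc 0 T) t :=
    (hfx t (q t)).comp_hasDerivWithinAt t hq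
  have h2 : HasDerivWithinAt (fun s => ∫ τ in t..s, ft τ (q s)) (ft t (q t)) (Icc 0 T) t := by
    rw [hasDerivWithinAt_iff_isLittleO, Asymptotics.isLittleO_iff]
    intro ε hε
    have hcont : ContinuousAt (Function.uncurry ft) (t, q t) := hft.continuousAt
    obtain ⟨δ, hδ, hδ'⟩ := Metric.continuousAt_iff.1 hcont ε hε
    have e1 : ∀ᶠ s in 𝓝[Icc 0 T] t, dist (q s) (q t) < δ :=
      hq.continuousWithinAt (Metric.ball_mem_nhds _ hδ)
    have e2 : ∀ᶠ s in 𝓝[Icc 0 T] t, dist s t < δ :=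
      nhdsWithin_le_nhds (Metric.ball_mem_nhds _ hδ)
    filter_upwards [e1, e2] with s hs1 hs2
    rw [intervalIntegral.integral_same, sub_zero]
    have hc : ∀ x, Continuous fun τ => ft τ x := fun x =>
      hft.comp (continuous_id.prodMk continuous_const)
    have : (∫ τ in t..s, ft τ (q s)) - (s - t) • ft t (q t)
        = ∫ τ in t..s, (ft τ (q s) - ft t (q t)) := by
      rw [intervalIntegral.integral_sub ((hc _).intervalIntegrable _ _)
        intervalIntegrable_const, intervalIntegral.integral_const]
    rw [this]
    refine intervalIntegral.norm_integral_le_of_norm_le_const fun τ hτ => ?_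
    have hτ' : dist τ t < δ := by
      refine lt_of_le_of_lt ?_ hs2
      rw [Real.dist_eq, Real.dist_eq]
      exact abs_sub_left_of_mem_uIcc (uIoc_subset_uIcc hτ)
    have := hδ' (x := (τ, q s)) (by rw [Prod.dist_eq]; exact max_lt hτ' hs1)
    rw [dist_eq_norm] at this
    exact this.le
  refine ((h1.add h2).congr (fun s hs => ?_) ?_)
  · simp only [Pi.add_apply]
    rw [← hf t ht s hs]
    ring
  · simp

namespace IsClassicalSolution

variable {b T : ℝ} {u v w : ℝ → ℝ → ℝ}

theorem continuous_u (hs : IsClassicalSolution b T u v w) (t : ℝ) : Continuous (u t) :=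
  hs.continuous_left.comp (continuous_const.prodMk continuous_id)

theorem continuous_v (hs : IsClassicalSolution b T u v w) (t : ℝ) : Continuous (v t) :=
  hs.continuous_right.comp (continuous_const.prodMk continuous_id)

theorem continuous_source (hs : IsClassicalSolution b T u v w) :
    Continuous (Function.uncurry fun t => source b (u t) (v t)) := by
  have h1 := hs.continuous_left
  have h2 := hs.continuous_right
  exact (continuous_const.mul (h1.pow 2)).add (continuous_const.mul (h2.pow 2))

theorem exists_source_bound (hs : IsClassicalSolution b T u v w) :
    ∃ K, 0 ≤ K ∧ ∀ t x, |source b (u t) (v t) x| ≤ K := by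
  obtain ⟨K, hK0, hK⟩ := hs.exists_bound
  refine ⟨|b / 2| * K ^ 2 + |(3 - b) / 2| * K ^ 2, by positivity, fun t x => ?_⟩
  unfold source
  refine (abs_add_le _ _).trans ?_
  rw [abs_mul, abs_mul, abs_pow, abs_pow]
  have h1 := (hK t x).1
  have h2 := (hK t x).2
  gcongr

theorem source_cont (hs : IsClassicalSolution b T u v w) (t : ℝ) :
    Continuous (source b (u t) (v t)) :=
  hs.continuous_source.comp (continuous_const.prodMk continuous_id)

theorem continuous_flux (hs : IsClassicalSolution b T u v w) :
    Continuous (Function.uncurry fun t => flux b (u t) (v t)) := by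
  obtain ⟨K, _, hK⟩ := hs.exists_source_bound
  exact (continuous_const.mul (hs.continuous_left.pow 2)).add
    (continuous_greenOp hs.continuous_source hK)

theorem continuous_fluxDeriv (hs : IsClassicalSolution b T u v w) :
    Continuous (Function.uncurry fun t => fluxDeriv b (u t) (v t)) := by
  obtain ⟨K, _, hK⟩ := hs.exists_source_bound
  exact (hs.continuous_left.mul hs.continuous_right).add
    (continuous_greenOpDeriv hs.continuous_source hK)

theorem hasDerivAt_flux (hs : IsClassicalSolution b T u v w) (t x : ℝ) :
    HasDerivAt (flux b (u t) (v t)) (fluxDeriv b (u t) (v t) x) x := by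
  obtain ⟨K, _, hK⟩ := hs.exists_source_bound
  have := (((hs.hasDerivAt t x).pow 2).const_mul (1 / 2)).add
    (hasDerivAt_greenOp (hs.source_cont t) (hK t) x)
  refine this.congr_deriv ?_
  unfold fluxDeriv
  push_cast
  ring

theorem flux_time_continuous (hs : IsClassicalSolution b T u v w) (x : ℝ) :
    Continuous fun t => flux b (u t) (v t) x :=
  hs.continuous_flux.comp (continuous_id.prodMk continuous_const)

theorem fluxDeriv_time_continuous (hs : IsClassicalSolution b T u v w) (x : ℝ) :
    Continuous fun t => fluxDeriv b (u t) (v t) x :=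
  hs.continuous_fluxDeriv.comp (continuous_id.prodMk continuous_const)

theorem exists_fluxDeriv_bound (hs : IsClassicalSolution b T u v w) :
    ∃ K, ∀ t x, |fluxDeriv b (u t) (v t) x| ≤ K := by
  obtain ⟨K, _, hK⟩ := hs.exists_source_bound
  obtain ⟨K', hK0', hK'⟩ := hs.exists_bound
  refine ⟨K' * K' + K, fun t x => (abs_add_le _ _).trans ?_⟩
  refine add_le_add ?_ (abs_greenOpDeriv_le (hK t) x)
  rw [abs_mul]
  exact mul_le_mul (hK' t x).1 (hK' t x).2 (abs_nonneg _) hK0'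

theorem conservation_sub (hs : IsClassicalSolution b T u v w) {s t : ℝ} (h : s ∈ Icc 0 T)
    (ht : t ∈ Icc 0 T) (x y : ℝ) : (∫ z in x..y, u t z) - ∫ z in x..y, u s z =
      ∫ τ in s..t, (flux b (u τ) (v τ) x - flux b (u τ) (v τ) y) := by
  have hc : Continuous fun τ => flux b (u τ) (v τ) x - flux b (u τ) (v τ) y :=
    (hs.flux_time_continuous x).sub (hs.flux_time_continuous y)
  rw [← intervalIntegral.integral_interval_sub_left (hc.intervalIntegrable 0 t)
    (hc.intervalIntegrable 0 s), ← hs.conservation t ht, ← hs.conservation s h]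
  ring

/-- Obtained by differentiating the conservation law on `[0,y]` with respect to the endpoint `y`. -/
theorem sub_eq_integral_fluxDeriv (hs : IsClassicalSolution b T u v w) {s t : ℝ}
    (h : s ∈ Icc 0 T) (ht : t ∈ Icc 0 T) (x : ℝ) :
    u t x - u s x = ∫ τ in s..t, -fluxDeriv b (u τ) (v τ) x := by
  obtain ⟨K, hK⟩ := hs.exists_fluxDeriv_bound
  have h1 : HasDerivAt (fun y => (∫ z in (0 : ℝ)..y, u t z) - ∫ z in (0 : ℝ)..y, u s z)
      (u t x - u s x) x :=
    ((hs.continuous_u t).integral_hasStrictDerivAt 0 x).hasDerivAt.sub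
      ((hs.continuous_u s).integral_hasStrictDerivAt 0 x).hasDerivAt
  have h2 := (intervalIntegral.hasDerivAt_integral_of_dominated_loc_of_deriv_le (μ := volume)
    (a := s) (b := t) (F := fun y τ => flux b (u τ) (v τ) 0 - flux b (u τ) (v τ) y)
    (F' := fun y τ => -fluxDeriv b (u τ) (v τ) y) (x₀ := x) (s := univ) (bound := fun _ => K)
    univ_mem
    (Eventually.of_forall fun y =>
      ((hs.flux_time_continuous 0).sub (hs.flux_time_continuous y)).aestronglyMeasurable)
    (((hs.flux_time_continuous 0).sub (hs.flux_time_continuous x)).intervalIntegrable _ _)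
    (hs.fluxDeriv_time_continuous x).neg.aestronglyMeasurable
    (Eventually.of_forall fun τ _ y _ => by rw [norm_neg]; exact hK τ y)
    intervalIntegrable_const
    (Eventually.of_forall fun τ _ y _ => (hs.hasDerivAt_flux τ y).const_sub _)).2
  refine h1.unique (h2.congr_of_eventuallyEq (Eventually.of_forall fun y => ?_))
  exact hs.conservation_sub h ht 0 y

/-! ### Characteristics -/

theorem lipschitz (hs : IsClassicalSolution b T u v w) {K : ℝ} (hK : ∀ t x, |v t x| ≤ K)
    (t x y : ℝ) : |u t y - u t x| ≤ K * |y - x| := by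
  have := Convex.norm_image_sub_le_of_norm_hasDerivWithin_le (s := univ) (f := u t) (f' := v t)
    (x := x) (y := y) (C := K)
    (fun z _ => (hs.hasDerivAt t z).hasDerivWithinAt) (fun z _ => hK t z) convex_univ trivial trivial
  simpa using this

/-- `q` is a characteristic of `u` on `[0,T]`. -/
structure _root_.IsCharacteristic (T : ℝ) (u : ℝ → ℝ → ℝ) (q : ℝ → ℝ) : Prop where
  continuous : Continuous q
  hasDerivWithinAt : ∀ t ∈ Icc 0 T, HasDerivWithinAt q (u t (q t)) (Icc 0 T) t

theorem exists_isCharacteristic (hs : IsClassicalSolution b T u v w) (hT : 0 ≤ T) (y : ℝ) :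
    ∃ q, q T = y ∧ IsCharacteristic T u q := by
  obtain ⟨K, hK0, hK⟩ := hs.exists_bound
  -- The speed is at most `K`, so the curve through `y` at the final time stays within distance `K *
  -- T` of `y` on all of `[0,T]`. It is later extended by constants to be continuous on the whole
  -- line.
  lift K to NNReal using hK0
  have : IsPicardLindelof u (⟨T, hT, le_rfl⟩ : Icc 0 T) y (K * T.toNNReal) 0 K K := by
    refine ⟨fun t _ => ?_, fun x _ => ?_, fun t _ x _ => (hK t x).1, ?_⟩
    · refine LipschitzOnWith.of_dist_le_mul fun x _ z _ => ?_
      rw [Real.dist_eq, Real.dist_eq]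
      exact hs.lipschitz (fun t x => (hK t x).2) t z x
    · exact (hs.continuous_left.comp (continuous_id.prodMk continuous_const)).continuousOn
    · simp only [sub_self, sub_zero, max_eq_right hT, NNReal.coe_zero]
      rw [NNReal.coe_mul, Real.coe_toNNReal T hT]
  obtain ⟨q, hqT, hq⟩ := this.exists_eq_forall_mem_Icc_hasDerivWithinAt₀
  have hc : ContinuousOn q (Icc 0 T) := fun t ht => (hq t ht).continuousWithinAt
  have e : ∀ t ∈ Icc 0 T, IccExtend hT ((Icc 0 T).domRestrict q) t = q t := fun t ht =>
    IccExtend_of_mem hT _ ht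
  refine ⟨IccExtend hT ((Icc 0 T).domRestrict q), by rw [e T ⟨hT, le_rfl⟩]; exact hqT,
    hc.domRestrict.Icc_extend', fun t ht => ?_⟩
  rw [e t ht]
  exact (hq t ht).congr e (e t ht)

/-- The gap `r` satisfies `|r'| ≤ K |r|`, so `r² e^{2Ks}` increases and `r² e^{-2Ks}` decreases. The
second fact keeps the gap from vanishing at earlier times, and the first bounds it by the final gap.
-/
theorem characteristic_gap (hs : IsClassicalSolution b T u v w) {K : ℝ}
    (hK : ∀ t x, |v t x| ≤ K) {q₁ q₂ : ℝ → ℝ}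
    (h₁ : IsCharacteristic T u q₁) (h₂ : IsCharacteristic T u q₂) (h : q₁ T < q₂ T) {s : ℝ}
    (hsT : s ∈ Icc 0 T) :
    q₁ s < q₂ s ∧ q₂ s - q₁ s ≤ Real.exp (K * T) * (q₂ T - q₁ T) := by
  have hK0 : 0 ≤ K := (abs_nonneg _).trans (hK 0 0)
  have hT : 0 ≤ T := hsT.1.trans hsT.2
  set r : ℝ → ℝ := fun s => q₂ s - q₁ s with hr
  have hrc : ContinuousOn r (Icc 0 T) := (h₂.continuous.sub h₁.continuous).continuousOn
  have hE : ∀ c x : ℝ, HasDerivAt (fun s => Real.exp (c * s)) (Real.exp (c * x) * c) x :=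
    fun c x => by simpa using ((hasDerivAt_id x).const_mul c).exp
  have hd : ∀ c : ℝ, ∀ x ∈ interior (Icc 0 T), HasDerivWithinAt
      (fun s => r s ^ 2 * Real.exp (c * s))
      ((2 * r x * (u x (q₂ x) - u x (q₁ x)) + c * r x ^ 2) * Real.exp (c * x))
      (interior (Icc 0 T)) x := fun c x hx => by
    have hx' := interior_subset hx
    have := ((((h₂.hasDerivWithinAt x hx').sub (h₁.hasDerivWithinAt x hx')).pow 2).mul (hE c x).hasDerivWithinAt).mono
      interior_subset
    refine this.congr_deriv ?_
    simp only [Pi.sub_apply, Pi.pow_apply, hr]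
    push_cast
    ring
  have hc : ∀ c : ℝ, ContinuousOn (fun s => r s ^ 2 * Real.exp (c * s)) (Icc 0 T) := fun c =>
    (hrc.pow 2).mul (by fun_prop)
  have hb : ∀ x, |2 * r x * (u x (q₂ x) - u x (q₁ x))| ≤ 2 * K * r x ^ 2 := fun x => by
    rw [abs_mul, abs_mul, abs_of_pos (by norm_num : (0 : ℝ) < 2), ← sq_abs (r x)]
    have := hs.lipschitz hK x (q₁ x) (q₂ x)
    nlinarith [abs_nonneg (r x)]
  have hmono : MonotoneOn (fun s => r s ^ 2 * Real.exp ((2 * K) * s)) (Icc 0 T) :=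
    monotoneOn_of_hasDerivWithinAt_nonneg (convex_Icc 0 T) (hc _) (hd _) fun x _ =>
      mul_nonneg (by linarith [(abs_le.1 (hb x)).1]) (Real.exp_pos _).le
  have hanti : AntitoneOn (fun s => r s ^ 2 * Real.exp (-(2 * K) * s)) (Icc 0 T) :=
    antitoneOn_of_hasDerivWithinAt_nonpos (convex_Icc 0 T) (hc _) (hd _) fun x _ =>
      mul_nonpos_of_nonpos_of_nonneg (by linarith [(abs_le.1 (hb x)).2]) (Real.exp_pos _).le
  have hTm : T ∈ Icc 0 T := ⟨hT, le_rfl⟩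
  have hrT : 0 < r T := sub_pos.2 h
  have hne : ∀ s ∈ Icc 0 T, r s ≠ 0 := fun s hs' h0 => by
    have := hanti hs' hTm hs'.2
    simp only [h0] at this
    have h3 : 0 < r T ^ 2 * Real.exp (-(2 * K) * T) := by positivity
    rw [zero_pow two_ne_zero, zero_mul] at this
    linarith
  have hpos : 0 < r s := by
    by_contra hneg
    have : (0 : ℝ) ∈ r '' Icc s T :=
      intermediate_value_Icc hsT.2 (hrc.mono (Icc_subset_Icc_left hsT.1)) ⟨not_lt.1 hneg, hrT.le⟩
    obtain ⟨z, hz, hz0⟩ := this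
    exact hne z ⟨hsT.1.trans hz.1, hz.2⟩ hz0
  refine ⟨sub_pos.1 hpos, ?_⟩
  have h4 := hmono hsT hTm hsT.2
  simp only at h4
  have h5 : r s ^ 2 ≤ (Real.exp (K * T) * r T) ^ 2 := by
    have : (1 : ℝ) ≤ Real.exp (2 * K * s) := Real.one_le_exp (by have := hsT.1; positivity)
    have e : (Real.exp (K * T) * r T) ^ 2 = r T ^ 2 * Real.exp (2 * K * T) := by
      rw [mul_pow, ← Real.exp_nat_mul]; push_cast; ring_nf
    rw [e]
    nlinarith [sq_nonneg (r s)]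
  exact abs_le_of_sq_le_sq' h5 (by positivity) |>.2

end IsClassicalSolution

/-! ### Sign of the momentum -/

/-- The integral over `[x,y]` of the momentum `u - u_xx`, with `v` in the place of `u_x`. -/
def momentumIntegral (u v : ℝ → ℝ) (x y : ℝ) : ℝ := (∫ z in x..y, u z) - (v y - v x)

/-- A Gronwall bound by the integrating factor `e^{-∫ a}`. One factor `e^{AT}` is lost inside the
error integral and another when the integrating factor is removed at time `T`; hence the 2 in the
exponent. -/
theorem neg_exp_mul_integral_abs_le_of_linear_ode {T A : ℝ} {D a e : ℝ → ℝ} (hT : 0 ≤ T)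
    (hA : ∀ t, |a t| ≤ A) (ha : Continuous a) (he : Continuous e)
    (hD : ∀ t ∈ Icc 0 T, HasDerivWithinAt D (a t * D t + e t) (Icc 0 T) t) (h0 : 0 ≤ D 0) :
    -(Real.exp (2 * (A * T)) * ∫ t in (0 : ℝ)..T, |e t|) ≤ D T := by
  set I : ℝ → ℝ := fun t => ∫ s in (0 : ℝ)..t, a s with hI
  have hId : ∀ t, HasDerivAt I (a t) t := fun t => (ha.integral_hasStrictDerivAt 0 t).hasDerivAt
  have hIc : Continuous I := continuous_iff_continuousAt.2 fun t => (hId t).continuousAt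
  have hIb : ∀ t ∈ Icc 0 T, |I t| ≤ A * T := fun t ht => by
    have hA0 : 0 ≤ A := (abs_nonneg _).trans (hA 0)
    have := intervalIntegral.norm_integral_le_of_norm_le_const (f := a) (a := 0) (b := t) (C := A)
      fun s _ => hA s
    rw [sub_zero, abs_of_nonneg ht.1] at this
    exact this.trans (mul_le_mul_of_nonneg_left ht.2 hA0)
  have hZ : ∀ t ∈ Icc 0 T, HasDerivWithinAt (fun t => D t * Real.exp (-I t))
      (e t * Real.exp (-I t)) (Icc 0 T) t := fun t ht => by
    have := (hD t ht).mul ((hId t).neg.exp).hasDerivWithinAt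
    refine this.congr_deriv ?_
    simp only [Pi.neg_apply]
    ring
  have hc : Continuous fun t => e t * Real.exp (-I t) := by fun_prop
  have hint := intervalIntegral.integral_eq_sub_of_hasDerivAt_of_le hT
    (fun t ht => (hZ t ht).continuousWithinAt)
    (fun t ht => (hZ t (Ioo_subset_Icc_self ht)).hasDerivAt (Icc_mem_nhds ht.1 ht.2))
    (hc.intervalIntegrable 0 T)
  have hI0 : I 0 = 0 := by simp [hI]
  simp only [hI0, neg_zero, Real.exp_zero, mul_one] at hint
  have hlow : -(Real.exp (A * T) * ∫ t in (0 : ℝ)..T, |e t|) ≤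
      ∫ t in (0 : ℝ)..T, e t * Real.exp (-I t) := by
    rw [← intervalIntegral.integral_const_mul, ← intervalIntegral.integral_neg]
    refine intervalIntegral.integral_mono_on hT
      (by apply Continuous.intervalIntegrable; fun_prop) (hc.intervalIntegrable 0 T)
      fun t ht => ?_
    have h1 : Real.exp (-I t) ≤ Real.exp (A * T) :=
      Real.exp_le_exp.2 (by linarith [(abs_le.1 (hIb t ht)).1])
    have h2 := Real.exp_pos (-I t)
    nlinarith [neg_abs_le (e t), abs_nonneg (e t)]
  have hJ : 0 ≤ ∫ t in (0 : ℝ)..T, |e t| :=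
    intervalIntegral.integral_nonneg hT fun t _ => abs_nonneg _
  have hDT : D T = (D T * Real.exp (-I T)) * Real.exp (I T) := by
    rw [mul_assoc, ← Real.exp_add]; simp
  have h3 : Real.exp (I T) ≤ Real.exp (A * T) :=
    Real.exp_le_exp.2 (abs_le.1 (hIb T ⟨hT, le_rfl⟩)).2
  have h4 : Real.exp (2 * (A * T)) = Real.exp (A * T) * Real.exp (A * T) := by
    rw [← Real.exp_add]; ring_nf
  rw [hDT, h4]
  have h5 : -(Real.exp (A * T) * ∫ t in (0 : ℝ)..T, |e t|) ≤ D T * Real.exp (-I T) := by linarith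
  have h6 : 0 ≤ Real.exp (A * T) * ∫ t in (0 : ℝ)..T, |e t| := by positivity
  have h7 := Real.exp_pos (I T)
  nlinarith

namespace IsClassicalSolution

variable {b T : ℝ} {u v w : ℝ → ℝ → ℝ}

/-- The right-hand side of the equation for `u_x` along characteristics. -/
def _root_.slopeRate (b : ℝ) (u v : ℝ → ℝ) (x : ℝ) : ℝ :=
  source b u v x - greenOp (source b u v) x - v x ^ 2

theorem continuous_slopeRate_comp (hs : IsClassicalSolution b T u v w) {q : ℝ → ℝ}
    (hq : Continuous q) : Continuous fun t => slopeRate b (u t) (v t) (q t) := by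
  obtain ⟨K, _, hK⟩ := hs.exists_source_bound
  have h1 := hs.continuous_source.comp (continuous_id.prodMk hq)
  have h2 := (continuous_greenOp hs.continuous_source hK).comp (continuous_id.prodMk hq)
  have h3 := hs.continuous_right.comp (continuous_id.prodMk hq)
  exact (h1.sub h2).sub (h3.pow 2)

theorem hasDerivWithinAt_comp (hs : IsClassicalSolution b T u v w) {q : ℝ → ℝ} {q' t : ℝ}
    (ht : t ∈ Icc 0 T) (hq : HasDerivWithinAt q q' (Icc 0 T) t) :
    HasDerivWithinAt (fun s => u s (q s)) (v t (q t) * q' + -fluxDeriv b (u t) (v t) (q t))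
      (Icc 0 T) t :=
  hasDerivWithinAt_comp_of_partial (ft := fun τ x => -fluxDeriv b (u τ) (v τ) x)
    (fun _ hs' _ ht' x => hs.sub_eq_integral_fluxDeriv hs' ht' x)
    hs.continuous_fluxDeriv.neg hs.hasDerivAt ht hq

/-- The second curve is the translate `q + ε`, not another characteristic. The transport terms then
combine into `v(q+ε)` times the difference quotient of `u`, and no second derivative of `u` appears.
-/
theorem integral_differenceQuotient (hs : IsClassicalSolution b T u v w) {q : ℝ → ℝ}
    (hq : IsCharacteristic T u q) {t : ℝ} (ht : t ∈ Icc 0 T) (ε : ℝ) :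
    ε⁻¹ * (u t (q t + ε) - u t (q t)) - ε⁻¹ * (u 0 (q 0 + ε) - u 0 (q 0)) =
      ∫ s in (0 : ℝ)..t, (-(v s (q s + ε) * (ε⁻¹ * (u s (q s + ε) - u s (q s)))) -
        ε⁻¹ * (greenOpDeriv (source b (u s) (v s)) (q s + ε) -
          greenOpDeriv (source b (u s) (v s)) (q s))) := by
  obtain ⟨K, _, hK⟩ := hs.exists_source_bound
  have hqc := hq.continuous
  have c1 : Continuous fun s => v s (q s + ε) :=
    hs.continuous_right.comp (continuous_id.prodMk (hqc.add continuous_const))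
  have c2 : Continuous fun s => u s (q s + ε) :=
    hs.continuous_left.comp (continuous_id.prodMk (hqc.add continuous_const))
  have c3 : Continuous fun s => u s (q s) := hs.continuous_left.comp (continuous_id.prodMk hqc)
  have c4 := (continuous_greenOpDeriv hs.continuous_source hK).comp
    (continuous_id.prodMk (hqc.add (continuous_const (y := ε))))
  have c5 := (continuous_greenOpDeriv hs.continuous_source hK).comp (continuous_id.prodMk hqc)
  have hd : ∀ s ∈ Icc 0 T, HasDerivWithinAt
      (fun s => ε⁻¹ * (u s (q s + ε) - u s (q s)))
      (-(v s (q s + ε) * (ε⁻¹ * (u s (q s + ε) - u s (q s)))) -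
        ε⁻¹ * (greenOpDeriv (source b (u s) (v s)) (q s + ε) -
          greenOpDeriv (source b (u s) (v s)) (q s))) (Icc 0 T) s := fun s hs' => by
    have h1 := hs.hasDerivWithinAt_comp hs' ((hq.hasDerivWithinAt s hs').add_const ε)
    have h2 := hs.hasDerivWithinAt_comp hs' (hq.hasDerivWithinAt s hs')
    refine ((h1.sub h2).const_mul ε⁻¹).congr_deriv ?_
    unfold fluxDeriv
    ring
  refine (intervalIntegral.integral_eq_sub_of_hasDerivAt_of_le
    (f := fun s => ε⁻¹ * (u s (q s + ε) - u s (q s))) ht.1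
    (continuous_const.mul (c2.sub c3)).continuousOn (fun s hs' => (hd s ⟨hs'.1.le, hs'.2.le.trans ht.2⟩).hasDerivAt
      (Icc_mem_nhds hs'.1 (hs'.2.trans_le ht.2))) ?_).symm
  exact ((c1.mul (continuous_const.mul (c2.sub c3))).neg.sub
    (continuous_const.mul (c4.sub c5))).intervalIntegrable _ _

/-- The limit `ε → 0⁺` of the identity for difference quotients. Lipschitz bounds on `u` and on the
derivative of the Green term dominate the integrand, and `∂_x² G h = G h - h` identifies the limit.
-/
theorem slope_sub_eq_integral (hs : IsClassicalSolution b T u v w) {q : ℝ → ℝ}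
    (hq : IsCharacteristic T u q) {t : ℝ} (ht : t ∈ Icc 0 T) :
    v t (q t) - v 0 (q 0) = ∫ s in (0 : ℝ)..t, slopeRate b (u s) (v s) (q s) := by
  obtain ⟨K, hK0, hK⟩ := hs.exists_source_bound
  obtain ⟨K', hK0', hK'⟩ := hs.exists_bound
  have hqc := hq.continuous
  have hg : ∀ s x, HasDerivAt (greenOpDeriv (source b (u s) (v s)))
      (greenOp (source b (u s) (v s)) x - source b (u s) (v s) x) x := fun s x =>
    hasDerivAt_greenOpDeriv (hs.source_cont s) (hK s) x
  have hgL : ∀ s x y, |greenOpDeriv (source b (u s) (v s)) y -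
      greenOpDeriv (source b (u s) (v s)) x| ≤ (K + K) * |y - x| := fun s x y => by
    refine Convex.norm_image_sub_le_of_norm_hasDerivWithin_le (s := univ)
      (fun z _ => (hg s z).hasDerivWithinAt) (fun z _ => ?_) convex_univ trivial trivial
    exact (abs_sub _ _).trans (add_le_add (abs_greenOp_le (hK s) z) (hK s z))
  have hL : Tendsto (fun ε : ℝ => ε⁻¹ * (u t (q t + ε) - u t (q t)) -
      ε⁻¹ * (u 0 (q 0 + ε) - u 0 (q 0))) (𝓝[>] 0) (𝓝 (v t (q t) - v 0 (q 0))) :=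
    (hs.hasDerivAt t (q t)).tendsto_slope_zero_right.sub
      (hs.hasDerivAt 0 (q 0)).tendsto_slope_zero_right
  simp only [hs.integral_differenceQuotient hq ht] at hL
  refine tendsto_nhds_unique hL ?_
  refine intervalIntegral.tendsto_integral_filter_of_dominated_convergence
    (fun _ => K' * K' + (K + K)) (Eventually.of_forall fun ε => ?_) ?_ intervalIntegrable_const
    (Eventually.of_forall fun s _ => ?_)
  · refine Continuous.aestronglyMeasurable ?_
    have c1 : Continuous fun s => v s (q s + ε) :=
      hs.continuous_right.comp (continuous_id.prodMk (hqc.add continuous_const))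
    have c2 : Continuous fun s => u s (q s + ε) :=
      hs.continuous_left.comp (continuous_id.prodMk (hqc.add continuous_const))
    have c3 : Continuous fun s => u s (q s) := hs.continuous_left.comp (continuous_id.prodMk hqc)
    have c4 := (continuous_greenOpDeriv hs.continuous_source hK).comp
      (continuous_id.prodMk (hqc.add (continuous_const (y := ε))))
    have c5 := (continuous_greenOpDeriv hs.continuous_source hK).comp (continuous_id.prodMk hqc)
    exact (c1.mul (continuous_const.mul (c2.sub c3))).neg.sub (continuous_const.mul (c4.sub c5))
  · filter_upwards [self_mem_nhdsWithin] with ε hε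
    have hε : 0 < ε := hε
    refine Eventually.of_forall fun s _ => ?_
    have h1 : |ε⁻¹ * (u s (q s + ε) - u s (q s))| ≤ K' := by
      rw [abs_mul, abs_of_pos (inv_pos.2 hε), inv_mul_le_iff₀ hε]
      have := hs.lipschitz (fun t x => (hK' t x).2) s (q s) (q s + ε)
      rwa [add_sub_cancel_left, abs_of_pos hε, mul_comm] at this
    have h2 : |ε⁻¹ * (greenOpDeriv (source b (u s) (v s)) (q s + ε) -
        greenOpDeriv (source b (u s) (v s)) (q s))| ≤ K + K := by
      rw [abs_mul, abs_of_pos (inv_pos.2 hε), inv_mul_le_iff₀ hε]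
      have := hgL s (q s) (q s + ε)
      rwa [add_sub_cancel_left, abs_of_pos hε, mul_comm] at this
    rw [Real.norm_eq_abs]
    refine (abs_sub _ _).trans (add_le_add ?_ h2)
    rw [abs_neg, abs_mul]
    exact mul_le_mul (hK' s _).2 h1 (abs_nonneg _) hK0'
  · have h1 := (hs.hasDerivAt s (q s)).tendsto_slope_zero_right
    have h2 := (hg s (q s)).tendsto_slope_zero_right
    have h3 : Tendsto (fun ε : ℝ => v s (q s + ε)) (𝓝[>] 0) (𝓝 (v s (q s))) := by
      have : Continuous fun ε : ℝ => v s (q s + ε) :=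
        (hs.continuous_v s).comp (continuous_const.add continuous_id)
      have := this.tendsto 0
      rw [add_zero] at this
      exact this.mono_left nhdsWithin_le_nhds
    have := (h3.mul h1).neg.sub h2
    have e : slopeRate b (u s) (v s) (q s) = -(v s (q s) * v s (q s)) -
        (greenOp (source b (u s) (v s)) (q s) - source b (u s) (v s) (q s)) := by
      unfold slopeRate
      ring
    rw [e]
    simpa only [smul_eq_mul] using this

theorem hasDerivWithinAt_slope (hs : IsClassicalSolution b T u v w) {q : ℝ → ℝ}
    (hq : IsCharacteristic T u q) {t : ℝ} (ht : t ∈ Icc 0 T) :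
    HasDerivWithinAt (fun s => v s (q s)) (slopeRate b (u t) (v t) (q t)) (Icc 0 T) t := by
  have := (((hs.continuous_slopeRate_comp hq.continuous).integral_hasStrictDerivAt
    0 t).hasDerivAt.const_add (v 0 (q 0))).hasDerivWithinAt (s := Icc 0 T)
  have e : ∀ s ∈ Icc 0 T, v s (q s) =
      v 0 (q 0) + ∫ s in (0 : ℝ)..s, slopeRate b (u s) (v s) (q s) := fun s hs' => by
    rw [← hs.slope_sub_eq_integral hq hs']
    ring
  exact this.congr e (e t ht)

theorem hasDerivWithinAt_primitive (hs : IsClassicalSolution b T u v w) {q : ℝ → ℝ} {q' t : ℝ}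
    (ht : t ∈ Icc 0 T) (hq : HasDerivWithinAt q q' (Icc 0 T) t) :
    HasDerivWithinAt (fun s => ∫ z in (0 : ℝ)..q s, u s z)
      (u t (q t) * q' + (flux b (u t) (v t) 0 - flux b (u t) (v t) (q t))) (Icc 0 T) t :=
  hasDerivWithinAt_comp_of_partial (f := fun t y => ∫ z in (0 : ℝ)..y, u t z)
    (ft := fun τ x => flux b (u τ) (v τ) 0 - flux b (u τ) (v τ) x)
    (fun _ hs' _ ht' x => hs.conservation_sub hs' ht' 0 x)
    (((hs.flux_time_continuous 0).comp continuous_fst).sub hs.continuous_flux)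
    (fun t x => ((hs.continuous_u t).integral_hasStrictDerivAt 0 x).hasDerivAt) ht hq

theorem integral_eq_sub (hs : IsClassicalSolution b T u v w) (t x y : ℝ) :
    ∫ z in x..y, u t z = (∫ z in (0 : ℝ)..y, u t z) - ∫ z in (0 : ℝ)..x, u t z :=
  (intervalIntegral.integral_interval_sub_left ((hs.continuous_u t).intervalIntegrable _ _)
    ((hs.continuous_u t).intervalIntegrable _ _)).symm

/-- The error in the linear equation for the momentum between two characteristics, when `u_x` is
replaced by its value on the left one. -/
def _root_.momentumError (b : ℝ) (u v : ℝ → ℝ) (x y : ℝ) : ℝ :=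
  -(b - 1) * ((u y ^ 2 - u x ^ 2) / 2 - (v y ^ 2 - v x ^ 2) / 2 - v x * momentumIntegral u v x y)

/-- The nonlocal terms from the mass and from the slope cancel. What remains is `-(b-1)` times the
increment of `(u² - u_x²)/2`, which is formally `-(b-1) ∫ u_x m`; it is split by freezing `u_x` at
the left endpoint. -/
theorem hasDerivWithinAt_momentumIntegral (hs : IsClassicalSolution b T u v w) {q₁ q₂ : ℝ → ℝ}
    (h₁ : IsCharacteristic T u q₁) (h₂ : IsCharacteristic T u q₂) {t : ℝ} (ht : t ∈ Icc 0 T) :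
    HasDerivWithinAt (fun s => momentumIntegral (u s) (v s) (q₁ s) (q₂ s))
      ((-(b - 1) * v t (q₁ t)) * momentumIntegral (u t) (v t) (q₁ t) (q₂ t) +
        momentumError b (u t) (v t) (q₁ t) (q₂ t)) (Icc 0 T) t := by
  have := ((hs.hasDerivWithinAt_primitive ht (h₂.hasDerivWithinAt t ht)).sub
    (hs.hasDerivWithinAt_primitive ht (h₁.hasDerivWithinAt t ht))).sub
    ((hs.hasDerivWithinAt_slope h₂ ht).sub (hs.hasDerivWithinAt_slope h₁ ht))
  refine (this.congr_deriv ?_).congr (fun s _ => ?_) ?_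
  · unfold momentumError slopeRate flux
    simp only [source]
    ring
  · simp only [momentumIntegral, hs.integral_eq_sub s (q₁ s) (q₂ s)]
    rfl
  · simp only [momentumIntegral, hs.integral_eq_sub t (q₁ t) (q₂ t)]
    rfl

theorem continuous_momentumIntegral (hs : IsClassicalSolution b T u v w) {q₁ q₂ : ℝ → ℝ}
    (h₁ : Continuous q₁) (h₂ : Continuous q₂) :
    Continuous fun s => momentumIntegral (u s) (v s) (q₁ s) (q₂ s) := by
  have hp : ∀ {q : ℝ → ℝ}, Continuous q → Continuous fun s => ∫ z in (0 : ℝ)..q s, u s z :=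
    fun hq => intervalIntegral.continuous_parametric_intervalIntegral_of_continuous
      hs.continuous_left hq
  have hv : ∀ {q : ℝ → ℝ}, Continuous q → Continuous fun s => v s (q s) := fun hq =>
    hs.continuous_right.comp (continuous_id.prodMk hq)
  unfold momentumIntegral
  simp only [hs.integral_eq_sub _ (q₁ _) (q₂ _)]
  exact ((hp h₂).sub (hp h₁)).sub ((hv h₂).sub (hv h₁))

theorem continuous_momentumError (hs : IsClassicalSolution b T u v w) {q₁ q₂ : ℝ → ℝ}
    (h₁ : Continuous q₁) (h₂ : Continuous q₂) :
    Continuous fun s => momentumError b (u s) (v s) (q₁ s) (q₂ s) := by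
  have hu : ∀ {q : ℝ → ℝ}, Continuous q → Continuous fun s => u s (q s) := fun hq =>
    hs.continuous_left.comp (continuous_id.prodMk hq)
  have hv : ∀ {q : ℝ → ℝ}, Continuous q → Continuous fun s => v s (q s) := fun hq =>
    hs.continuous_right.comp (continuous_id.prodMk hq)
  have hm := hs.continuous_momentumIntegral h₁ h₂
  have a1 := hu h₁
  have a2 := hu h₂
  have a3 := hv h₁
  have a4 := hv h₂
  exact continuous_const.mul (((((a2.pow 2).sub (a1.pow 2)).div_const 2).sub
    (((a4.pow 2).sub (a3.pow 2)).div_const 2)).sub (a3.mul hm))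

/-- Formally the error is `-(b-1) ∫ (u_x - u_x(x)) (u - u_xx)`. The part with `u_xx` integrates
exactly to a square of the increment of `u_x`; the Cauchy–Schwarz bound `sub_sq_le` controls that
square and the oscillation of `u_x` in the other part. -/
theorem abs_momentumError_le (hs : IsClassicalSolution b T u v w) {K W l : ℝ} {t x y : ℝ}
    (hK : ∀ t x, |u t x| ≤ K) (hW : ∫ z, w t z ^ 2 ≤ W) (hxy : x ≤ y) (hl : y - x ≤ l) :
    |momentumError b (u t) (v t) x y| ≤
      |b - 1| * (√(l * W) * K * (y - x) + l / 2 * ∫ z in x..y, w t z ^ 2) := by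
  have hl0 : 0 ≤ l := (sub_nonneg.2 hxy).trans hl
  have hW' : ∀ z, x ≤ z → ∫ z in x..z, w t z ^ 2 ≤ W := fun z hz => by
    refine le_trans ?_ hW
    rw [intervalIntegral.integral_of_le hz]
    exact setIntegral_le_integral (hs.integrable_sq t) (Eventually.of_forall fun _ => sq_nonneg _)
  have hw0 : ∀ z, x ≤ z → 0 ≤ ∫ z in x..z, w t z ^ 2 := fun z hz =>
    intervalIntegral.integral_nonneg hz fun _ _ => sq_nonneg _
  have hsq : ∀ z ∈ uIoc x y, ‖(v t z - v t x) * u t z‖ ≤ √(l * W) * K := fun z hz => by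
    rw [uIoc_of_le hxy] at hz
    rw [norm_mul]
    refine mul_le_mul ?_ (hK t z) (abs_nonneg _) (Real.sqrt_nonneg _)
    refine Real.abs_le_sqrt ((hs.sub_sq_le t x z hz.1.le).trans ?_)
    exact mul_le_mul (by linarith [hz.2]) (hW' z hz.1.le) (hw0 z hz.1.le) hl0
  have hu : ∫ z in x..y, v t z * u t z = (u t y ^ 2 - u t x ^ 2) / 2 := by
    have := intervalIntegral.integral_eq_sub_of_hasDerivAt (a := x) (b := y)
      (f := fun z => u t z ^ 2 / 2) (f' := fun z => v t z * u t z)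
      (fun z _ => (((hs.hasDerivAt t z).pow 2).div_const 2).congr_deriv (by push_cast; ring))
      (((hs.continuous_v t).mul (hs.continuous_u t)).intervalIntegrable _ _)
    rw [this]
    ring
  have hi : ∫ z in x..y, (v t z - v t x) * u t z =
      (u t y ^ 2 - u t x ^ 2) / 2 - v t x * ∫ z in x..y, u t z := by
    simp only [sub_mul]
    have i1 : IntervalIntegrable (fun z => v t z * u t z) volume x y :=
      ((hs.continuous_v t).mul (hs.continuous_u t)).intervalIntegrable _ _
    have i2 : IntervalIntegrable (fun z => v t x * u t z) volume x y :=
      (continuous_const.mul (hs.continuous_u t)).intervalIntegrable _ _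
    rw [intervalIntegral.integral_sub i1 i2, hu, intervalIntegral.integral_const_mul]
  have e : momentumError b (u t) (v t) x y = -(b - 1) *
      ((∫ z in x..y, (v t z - v t x) * u t z) - (v t y - v t x) ^ 2 / 2) := by
    rw [hi]
    unfold momentumError momentumIntegral
    ring
  rw [e, abs_mul, abs_neg]
  refine mul_le_mul_of_nonneg_left ((abs_sub _ _).trans (add_le_add ?_ ?_)) (abs_nonneg _)
  · have := intervalIntegral.norm_integral_le_of_norm_le_const hsq
    rwa [abs_of_nonneg (sub_nonneg.2 hxy)] at this
  · rw [abs_of_nonneg (by positivity)]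
    have h1 := hs.sub_sq_le t x y hxy
    have h2 := mul_le_mul_of_nonneg_right hl (hw0 y hxy)
    linarith

end IsClassicalSolution

/-- Formally `f = u - u_x` satisfies `f + f' = m ≥ 0`, so `e^x f` increases. A negative value of `f`
at `c` would then force exponential growth of `|f|` towards `-∞`, against boundedness. The
integrated form `f a ≤ f c + ∫ z in a..c, f z` avoids differentiating `v`. -/
theorem le_of_momentumIntegral_nonneg {u v : ℝ → ℝ} {K : ℝ} (hd : ∀ x, HasDerivAt u (v x) x)
    (hv : Continuous v) (hK : ∀ x, |u x| ≤ K ∧ |v x| ≤ K)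
    (hm : ∀ x y, x ≤ y → 0 ≤ momentumIntegral u v x y) (c : ℝ) : v c ≤ u c := by
  have hu : Continuous u := continuous_iff_continuousAt.2 fun x => (hd x).continuousAt
  by_contra! hc
  set f : ℝ → ℝ := fun z => u z - v z with hf
  have hfc : Continuous f := hu.sub hv
  have hneg : f c < 0 := sub_neg.2 hc
  set G : ℝ → ℝ := fun a => f c + ∫ z in a..c, f z with hG
  have hle : ∀ a ≤ c, f a ≤ G a := fun a ha => by
    have h1 := hm a c ha
    have h2 : ∫ z in a..c, v z = u c - u a :=
      intervalIntegral.integral_eq_sub_of_hasDerivAt (fun z _ => hd z) (hv.intervalIntegrable _ _)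
    have h3 : ∫ z in a..c, f z = (∫ z in a..c, u z) - ∫ z in a..c, v z :=
      intervalIntegral.integral_sub (hu.intervalIntegrable _ _) (hv.intervalIntegrable _ _)
    unfold momentumIntegral at h1
    simp only [hG, hf]
    linarith
  have hGd : ∀ a, HasDerivAt G (-f a) a := fun a =>
    (intervalIntegral.integral_hasDerivAt_left (hfc.intervalIntegrable _ _)
      hfc.aestronglyMeasurable.stronglyMeasurableAtFilter hfc.continuousAt).const_add _
  have hmono : MonotoneOn (fun a => Real.exp a * G a) (Iic c) := by
    refine monotoneOn_of_hasDerivWithinAt_nonneg (convex_Iic c)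
      (fun a _ => ((Real.hasDerivAt_exp a).mul (hGd a)).continuousAt.continuousWithinAt)
      (fun a _ => ((Real.hasDerivAt_exp a).mul (hGd a)).hasDerivWithinAt) fun a ha => ?_
    have := hle a (mem_Iic.1 (interior_subset ha))
    have h2 := Real.exp_pos a
    nlinarith
  -- With this distance, `e^r ≥ 1 + r` gives `f c * e^r ≤ f c - 2K < -2K`, below the lower bound for
  -- `f`.
  set r : ℝ := 2 * K / (-f c) with hr
  have hK0 : 0 ≤ K := (abs_nonneg _).trans (hK 0).1
  have hr0 : 0 ≤ r := div_nonneg (by linarith) (by linarith)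
  have h1 := hmono (a := c - r) (b := c) (by simpa using hr0) (mem_Iic.2 le_rfl) (by linarith)
  simp only at h1
  have hGc : G c = f c := by simp [hG]
  rw [hGc, Real.exp_sub, div_mul_eq_mul_div, div_le_iff₀ (Real.exp_pos r)] at h1
  have h2 := hle (c - r) (by linarith)
  have h3 : -(2 * K) ≤ f (c - r) := by
    have := hK (c - r)
    simp only [hf]
    linarith [(abs_le.1 this.1).1, (abs_le.1 this.2).2]
  have h4 : G (c - r) ≤ f c * Real.exp r := by
    have := Real.exp_pos c
    have h5 : Real.exp c * G (c - r) ≤ Real.exp c * (f c * Real.exp r) := by linarith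
    exact le_of_mul_le_mul_left h5 this
  have h5 := Real.add_one_le_exp r
  have h6 : r * (-f c) = 2 * K := div_mul_cancel₀ _ (by linarith)
  nlinarith

theorem abs_le_of_momentumIntegral_nonneg {u v : ℝ → ℝ} {K : ℝ} (hd : ∀ x, HasDerivAt u (v x) x)
    (hv : Continuous v) (hK : ∀ x, |u x| ≤ K ∧ |v x| ≤ K)
    (hm : ∀ x y, x ≤ y → 0 ≤ momentumIntegral u v x y) (x : ℝ) : |v x| ≤ u x := by
  refine abs_le'.2 ⟨le_of_momentumIntegral_nonneg hd hv hK hm x, ?_⟩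
  -- The condition on the momentum is invariant under `x ↦ -x`, which changes the sign of the slope.
  have := le_of_momentumIntegral_nonneg (u := fun y => u (-y)) (v := fun y => -v (-y)) (K := K)
    (fun y => ((hd (-y)).comp y (hasDerivAt_neg y)).congr_deriv (by ring)) (by fun_prop)
    (fun y => ⟨(hK (-y)).1, by rw [abs_neg]; exact (hK (-y)).2⟩) (fun y z hyz => ?_) (-x)
  · simpa using this
  · have h := hm (-z) (-y) (by linarith)
    unfold momentumIntegral at h ⊢
    rw [intervalIntegral.integral_comp_neg]
    linarith

namespace IsClassicalSolution

variable {b T : ℝ} {u v w : ℝ → ℝ → ℝ}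

/-- The interval is cut into `n` equal pieces at time `T`, and the division points are traced back
along characteristics. The number `l` bounds every gap at every earlier time. The gaps and the
integrals of `w²` telescope, so the total error is `O(√l + l)`, with constants independent of `n`.
-/
theorem neg_le_momentumIntegral (hs : IsClassicalSolution b T u v w) (hT : 0 ≤ T) {K W : ℝ}
    (hK : ∀ t x, |u t x| ≤ K ∧ |v t x| ≤ K) (hW : ∀ t, ∫ z, w t z ^ 2 ≤ W)
    (hm : ∀ x y, x ≤ y → 0 ≤ momentumIntegral (u 0) (v 0) x y) {x y : ℝ} (hxy : x < y) {n : ℕ}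
    (hn : 0 < n) {l : ℝ} (hl : l = Real.exp (K * T) * ((y - x) / n)) :
    -(Real.exp (2 * (|b - 1| * K * T)) * (T * (|b - 1| *
      (√(l * W) * K * (Real.exp (K * T) * (y - x)) + l / 2 * W)))) ≤
      momentumIntegral (u T) (v T) x y := by
  have hn' : (0 : ℝ) < n := Nat.cast_pos.2 hn
  have hK0 : 0 ≤ K := (abs_nonneg _).trans (hK 0 0).1
  have hδ : 0 < (y - x) / n := div_pos (sub_pos.2 hxy) hn'
  have hl0 : 0 ≤ l := by rw [hl]; positivity
  choose q hqT hq using fun z => hs.exists_isCharacteristic hT z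
  set p : ℕ → ℝ := fun i => x + i * ((y - x) / n) with hp
  have hp0 : p 0 = x := by simp [hp]
  have hpn : p n = y := by simp only [hp]; field_simp; ring
  have hpd : ∀ i, p (i + 1) - p i = (y - x) / n := fun i => by simp only [hp]; push_cast; ring
  have hTm : T ∈ Icc 0 T := ⟨hT, le_rfl⟩
  have hgap : ∀ a c, a < c → ∀ s ∈ Icc 0 T,
      q a s < q c s ∧ q c s - q a s ≤ Real.exp (K * T) * (c - a) := fun a c hac s hs' => by
    have := hs.characteristic_gap (fun t x => (hK t x).2) (hq a) (hq c)
      (by rw [hqT, hqT]; exact hac) hs'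
    rwa [hqT, hqT] at this
  set e : ℕ → ℝ → ℝ := fun i s =>
    momentumError b (u s) (v s) (q (p i) s) (q (p (i + 1)) s) with he
  have hec : ∀ i, Continuous (e i) := fun i =>
    hs.continuous_momentumError (hq _).continuous (hq _).continuous
  have hi : ∀ i, -(Real.exp (2 * (|b - 1| * K * T)) * ∫ s in (0 : ℝ)..T, |e i s|) ≤
      momentumIntegral (u T) (v T) (p i) (p (i + 1)) := fun i => by
    have := neg_exp_mul_integral_abs_le_of_linear_ode (A := |b - 1| * K)
      (D := fun s => momentumIntegral (u s) (v s) (q (p i) s) (q (p (i + 1)) s))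
      (a := fun s => -(b - 1) * v s (q (p i) s)) (e := e i) hT
      (fun s => by
        rw [abs_mul, abs_neg]
        exact mul_le_mul_of_nonneg_left (hK _ _).2 (abs_nonneg _))
      (continuous_const.mul (hs.continuous_right.comp (continuous_id.prodMk (hq _).continuous)))
      (hec i) (fun s hs' => hs.hasDerivWithinAt_momentumIntegral (hq _) (hq _) hs')
      (hm _ _ (hgap _ _ (by linarith [hpd i]) 0 ⟨le_rfl, hT⟩).1.le)
    simpa only [hqT] using this
  have hsum : ∀ s ∈ Icc 0 T, ∑ i ∈ Finset.range n, |e i s| ≤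
      |b - 1| * (√(l * W) * K * (Real.exp (K * T) * (y - x)) + l / 2 * W) := fun s hs' => by
    have h1 : ∀ i ∈ Finset.range n, |e i s| ≤ |b - 1| * (√(l * W) * K *
        (q (p (i + 1)) s - q (p i) s) + l / 2 * ∫ z in q (p i) s..q (p (i + 1)) s, w s z ^ 2) :=
      fun i _ => by
        have hg := hgap (p i) (p (i + 1)) (by linarith [hpd i]) s hs'
        rw [hpd, ← hl] at hg
        exact hs.abs_momentumError_le (fun t x => (hK t x).1) (hW s) hg.1.le hg.2
    refine (Finset.sum_le_sum h1).trans ?_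
    rw [← Finset.mul_sum, Finset.sum_add_distrib, ← Finset.mul_sum, ← Finset.mul_sum,
      Finset.sum_range_sub (fun i => q (p i) s),
      intervalIntegral.sum_integral_adjacent_intervals
        (fun i _ => (hs.integrable_sq s).intervalIntegrable), hp0, hpn]
    have hg := hgap x y hxy s hs'
    have h2 : ∫ z in q x s..q y s, w s z ^ 2 ≤ W := by
      rw [intervalIntegral.integral_of_le hg.1.le]
      exact (setIntegral_le_integral (hs.integrable_sq s)
        (Eventually.of_forall fun _ => sq_nonneg _)).trans (hW s)
    have h3 := hg.2
    gcongr
  have htel : ∑ i ∈ Finset.range n, momentumIntegral (u T) (v T) (p i) (p (i + 1)) =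
      momentumIntegral (u T) (v T) x y := by
    simp only [momentumIntegral]
    rw [Finset.sum_sub_distrib, Finset.sum_range_sub (fun i => v T (p i)),
      intervalIntegral.sum_integral_adjacent_intervals
        (fun i _ => (hs.continuous_u T).intervalIntegrable _ _), hp0, hpn]
  rw [← htel]
  refine le_trans ?_ (Finset.sum_le_sum fun i _ => hi i)
  rw [Finset.sum_neg_distrib, ← Finset.mul_sum]
  refine neg_le_neg (mul_le_mul_of_nonneg_left ?_ (Real.exp_pos _).le)
  rw [← intervalIntegral.integral_finsetSum fun i _ => (hec i).abs.intervalIntegrable _ _]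
  have hc : Continuous fun s => ∑ i ∈ Finset.range n, |e i s| :=
    continuous_finsetSum _ fun i _ => (hec i).abs
  have := intervalIntegral.integral_mono_on hT (hc.intervalIntegrable 0 T)
    (intervalIntegrable_const (μ := volume)) hsum
  rwa [intervalIntegral.integral_const, sub_zero, smul_eq_mul] at this

theorem momentumIntegral_nonneg (hs : IsClassicalSolution b T u v w) (hT : 0 ≤ T)
    (hm : ∀ x y, x ≤ y → 0 ≤ momentumIntegral (u 0) (v 0) x y) (x y : ℝ) (hxy : x ≤ y) :
    0 ≤ momentumIntegral (u T) (v T) x y := by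
  rcases hxy.eq_or_lt with rfl | hlt
  · simp [momentumIntegral]
  obtain ⟨K, hK0, hK⟩ := hs.exists_bound
  obtain ⟨W, hW⟩ := hs.exists_integral_sq_le
  have hl : Tendsto (fun n : ℕ => Real.exp (K * T) * ((y - x) / n)) atTop (𝓝 0) := by
    simpa using (tendsto_const_div_atTop_nhds_zero_nat (y - x)).const_mul (Real.exp (K * T))
  have hc : Continuous fun l : ℝ => -(Real.exp (2 * (|b - 1| * K * T)) * (T * (|b - 1| *
      (√(l * W) * K * (Real.exp (K * T) * (y - x)) + l / 2 * W)))) := by fun_prop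
  have h := (hc.tendsto 0).comp hl
  simp only [zero_mul, Real.sqrt_zero, zero_div, add_zero, mul_zero, neg_zero] at h
  refine le_of_tendsto h ?_
  filter_upwards [eventually_gt_atTop 0] with n hn
  exact hs.neg_le_momentumIntegral hT hK hW hm hlt hn rfl

theorem mono (hs : IsClassicalSolution b T u v w) {T' : ℝ} (h : T' ≤ T) :
    IsClassicalSolution b T' u v w :=
  { hs with conservation := fun t ht => hs.conservation t ⟨ht.1, ht.2.trans h⟩ }

theorem abs_le (hs : IsClassicalSolution b T u v w)
    (hm : ∀ x y, x ≤ y → 0 ≤ momentumIntegral (u 0) (v 0) x y) {t : ℝ} (ht : t ∈ Icc 0 T)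
    (x : ℝ) : |v t x| ≤ u t x := by
  obtain ⟨K, _, hK⟩ := hs.exists_bound
  exact abs_le_of_momentumIntegral_nonneg (hs.hasDerivAt t) (hs.continuous_v t) (hK t)
    ((hs.mono ht.2).momentumIntegral_nonneg ht.1 hm) x

end IsClassicalSolution

/-! ### Mass transport -/

/-- The bound `|u'| ≤ u` says that `e^z u` increases and `e^{-z} u` decreases. This lets the Green
kernel be absorbed into `u x`. -/
theorem exp_neg_abs_mul_le {u v : ℝ → ℝ} (hd : ∀ x, HasDerivAt u (v x) x)
    (hv : ∀ x, |v x| ≤ u x) (x y : ℝ) : Real.exp (-|x - y|) * u y ≤ u x := by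
  have h1 : Monotone fun z => Real.exp z * u z :=
    monotone_of_hasDerivAt_nonneg (fun z => (Real.hasDerivAt_exp z).mul (hd z)) fun z => by
      have := (abs_le.1 (hv z)).1
      have := Real.exp_pos z
      simp only [Pi.zero_apply]
      nlinarith
  have hE : ∀ z, HasDerivAt (fun z : ℝ => Real.exp (-z)) (-Real.exp (-z)) z := fun z => by
    simpa using (hasDerivAt_neg z).exp
  have h2 : Antitone fun z => Real.exp (-z) * u z :=
    antitone_of_hasDerivAt_nonpos (fun z => (hE z).mul (hd z)) fun z => by
      have := (abs_le.1 (hv z)).2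
      have := Real.exp_pos (-z)
      simp only [Pi.zero_apply]
      nlinarith
  rcases le_total y x with h | h
  · rw [abs_of_nonneg (sub_nonneg.2 h)]
    have := h1 h
    simp only at this
    rw [neg_sub, Real.exp_sub, div_mul_eq_mul_div, div_le_iff₀ (Real.exp_pos x)]
    linarith
  · rw [abs_of_nonpos (sub_nonpos.2 h), neg_neg]
    have := h2 h
    simp only [Real.exp_neg] at this
    rw [Real.exp_sub, div_mul_eq_mul_div, div_le_iff₀ (Real.exp_pos y)]
    rw [inv_mul_le_iff₀ (Real.exp_pos y)] at this
    have h3 := Real.exp_pos x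
    have h4 : Real.exp x * u y ≤ Real.exp x * (Real.exp y * ((Real.exp x)⁻¹ * u x)) :=
      mul_le_mul_of_nonneg_left this h3.le
    have h5 : Real.exp x * (Real.exp y * ((Real.exp x)⁻¹ * u x)) = u x * Real.exp y := by
      field_simp
    linarith

theorem integrable_of_abs_deriv_le {u v : ℝ → ℝ} (hc : Continuous v) (hv : ∀ x, |v x| ≤ u x)
    (hu : Integrable u) : Integrable v :=
  hu.mono' hc.aestronglyMeasurable (Eventually.of_forall hv)

/-- Both `u` and `u'` are integrable, so `u` vanishes at infinity and `u x = -∫_x^∞ u'`. -/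
theorem le_integral_Ioi_of_abs_deriv_le {u v : ℝ → ℝ} (hd : ∀ x, HasDerivAt u (v x) x)
    (hc : Continuous v) (hv : ∀ x, |v x| ≤ u x) (hu : Integrable u) (x : ℝ) :
    u x ≤ ∫ y in Ioi x, u y := by
  have hvi := integrable_of_abs_deriv_le hc hv hu
  have h0 := tendsto_zero_of_hasDerivAt_of_integrableOn_Ioi (a := x) (fun y _ => hd y)
    hvi.integrableOn hu.integrableOn
  have h1 := integral_Ioi_of_hasDerivAt_of_tendsto' (a := x) (fun y _ => hd y)
    hvi.integrableOn h0
  have h2 : -∫ y in Ioi x, v y ≤ ∫ y in Ioi x, u y := by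
    rw [← integral_neg]
    exact integral_mono hvi.neg.integrableOn hu.integrableOn fun y => by
      have := (abs_le.1 (hv y)).1
      simp only
      linarith
  linarith

theorem source_nonneg {b : ℝ} (hb0 : 0 < b) (hb3 : b < 3) (u v : ℝ → ℝ) (x : ℝ) :
    0 ≤ source b u v x :=
  add_nonneg (mul_nonneg (by linarith) (sq_nonneg _)) (mul_nonneg (by linarith) (sq_nonneg _))

theorem flux_nonneg {b : ℝ} (hb0 : 0 < b) (hb3 : b < 3) (u v : ℝ → ℝ) (x : ℝ) :
    0 ≤ flux b u v x :=
  add_nonneg (by positivity) (greenOp_nonneg (source_nonneg hb0 hb3 u v) x)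

/-- The constant is `1/2 + 3/4`. The local term uses `u ≤ L`. In the Green term the source is at
most `3/2 u²`, since `b/2 + (3-b)/2 = 3/2`; one factor `u y` is absorbed with the kernel into `u x`,
and the other integrates to at most `L`. -/
theorem flux_le {b L : ℝ} (hb0 : 0 < b) (hb3 : b < 3) {u v : ℝ → ℝ}
    (hd : ∀ x, HasDerivAt u (v x) x) (hc : Continuous v) (hv : ∀ x, |v x| ≤ u x)
    (hu : Integrable u) (hL : ∫ x, u x ≤ L) (x : ℝ) : flux b u v x ≤ 5 / 4 * L * u x := by
  have hu0 : ∀ x, 0 ≤ u x := fun x => (abs_nonneg _).trans (hv x)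
  have h1 : u x ≤ L := (le_integral_Ioi_of_abs_deriv_le hd hc hv hu x).trans
    ((setIntegral_le_integral hu (Eventually.of_forall hu0)).trans hL)
  have hsrc : ∀ y, source b u v y ≤ 3 / 2 * u y ^ 2 := fun y => by
    have := sq_le_sq' (by linarith [(abs_le.1 (hv y)).1, hu0 y]) (abs_le.1 (hv y)).2
    unfold source
    nlinarith
  have h2 : greenOp (source b u v) x ≤ ∫ y, 3 / 4 * u x * u y := by
    refine integral_mono_of_nonneg (Eventually.of_forall fun y => ?_) (hu.const_mul _)
      (Eventually.of_forall fun y => ?_)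
    · exact mul_nonneg (by positivity) (source_nonneg hb0 hb3 u v y)
    · have h3 := exp_neg_abs_mul_le hd hv x y
      have h4 := Real.exp_pos (-|x - y|)
      have h5 := mul_le_mul_of_nonneg_left (hsrc y) h4.le
      have h6 := mul_le_mul_of_nonneg_right h3 (hu0 y)
      simp only
      linarith
  rw [integral_const_mul] at h2
  have h7 := mul_le_mul_of_nonneg_left hL (mul_nonneg (by norm_num : (0 : ℝ) ≤ 3 / 4) (hu0 x))
  have h8 := mul_le_mul_of_nonneg_right h1 (hu0 x)
  unfold flux
  nlinarith

theorem integrable_of_intervalIntegral_le {f : ℝ → ℝ} {L : ℝ} (hf : Continuous f)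
    (h0 : ∀ x, 0 ≤ f x) (h : ∀ x y, x ≤ y → ∫ z in x..y, f z ≤ L) :
    Integrable f ∧ ∫ x, f x ≤ L := by
  have h1 : Tendsto (fun n : ℕ => -(n : ℝ)) atTop atBot :=
    tendsto_neg_atTop_atBot.comp tendsto_natCast_atTop_atTop
  have h2 : Tendsto (fun n : ℕ => (n : ℝ)) atTop atTop := tendsto_natCast_atTop_atTop
  have hi : Integrable f := integrable_of_intervalIntegral_norm_bounded L
    (fun n : ℕ => (hf.integrableOn_Icc (a := -(n : ℝ)) (b := n)).mono_set Ioc_subset_Icc_self)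
    h1 h2 (Eventually.of_forall fun n => by
      simp only [Real.norm_of_nonneg (h0 _)]
      exact h _ _ (by linarith [n.cast_nonneg (α := ℝ)]))
  exact ⟨hi, le_of_tendsto (intervalIntegral_tendsto_integral hi h1 h2)
    (Eventually.of_forall fun n => h _ _ (by linarith [n.cast_nonneg (α := ℝ)]))⟩

namespace IsClassicalSolution

variable {b T : ℝ} {u v w : ℝ → ℝ → ℝ}

/-- If the flux is at most `c u`, then no mass overtakes a point that moves with speed `c`. -/
theorem integral_front_le (hs : IsClassicalSolution b T u v w) (hb0 : 0 < b) (hb3 : b < 3)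
    (hT : 0 ≤ T) {c : ℝ} (hc : ∀ s ∈ Icc 0 T, ∀ x, flux b (u s) (v s) x ≤ c * u s x) (y Y : ℝ) :
    ∫ z in (y + c * T)..Y, u T z ≤ ∫ z in y..Y, u 0 z := by
  have hd : ∀ s ∈ Icc 0 T, HasDerivWithinAt (fun s => ∫ z in (y + c * s)..Y, u s z)
      (c * -u s (y + c * s) + flux b (u s) (v s) (y + c * s) - flux b (u s) (v s) Y)
      (Icc 0 T) s := fun s hs' => by
    have h1 : HasDerivWithinAt (fun s => y + c * s) c (Icc 0 T) s := by
      simpa using (((hasDerivAt_id s).const_mul c).const_add y).hasDerivWithinAt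
    have h2 := (hs.hasDerivWithinAt_primitive hs' (hasDerivWithinAt_const s _ Y)).sub
      (hs.hasDerivWithinAt_primitive hs' h1)
    refine (h2.congr_deriv (by ring)).congr (fun s _ => hs.integral_eq_sub _ _ _)
      (hs.integral_eq_sub _ _ _)
  -- At the moving left end the inflow is `flux - c u ≤ 0`; at the fixed end `Y` mass can only
  -- leave, because the flux is nonnegative.
  have := antitoneOn_of_hasDerivWithinAt_nonpos (convex_Icc 0 T)
    (fun s hs' => (hd s hs').continuousWithinAt)
    (fun s hs' => (hd s (interior_subset hs')).mono interior_subset)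
    (fun s hs' => by
      have h1 := hc s (interior_subset hs') (y + c * s)
      have h2 := flux_nonneg hb0 hb3 (u s) (v s) Y
      linarith) (a := 0) (b := T) ⟨le_rfl, hT⟩ ⟨hT, le_rfl⟩ hT
  simpa using this

/-- The mass of a solution with nonnegative momentum does not increase. -/
theorem integrable_and_integral_le (hs : IsClassicalSolution b T u v w) (hb0 : 0 < b)
    (hb3 : b < 3) (hm : ∀ x y, x ≤ y → 0 ≤ momentumIntegral (u 0) (v 0) x y)
    (hi : Integrable (u 0)) {t : ℝ} (ht : t ∈ Icc 0 T) :
    Integrable (u t) ∧ ∫ x, u t x ≤ ∫ x, u 0 x := by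
  have hT : 0 ≤ T := ht.1.trans ht.2
  have h0 : ∀ s ∈ Icc 0 T, ∀ x, 0 ≤ u s x := fun s hs' x =>
    (abs_nonneg _).trans (hs.abs_le hm hs' x)
  have hS : ∀ x y, x ≤ y → ∫ z in x..y, u 0 z ≤ ∫ x, u 0 x := fun x y hxy => by
    rw [intervalIntegral.integral_of_le hxy]
    exact setIntegral_le_integral hi (Eventually.of_forall (h0 0 ⟨le_rfl, hT⟩))
  obtain ⟨K, hK0, hK⟩ := hs.exists_source_bound
  obtain ⟨K', hK0', hK'⟩ := hs.exists_bound
  have hF : ∀ s x, flux b (u s) (v s) x ≤ K' ^ 2 + K := fun s x => by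
    have h1 := (le_abs_self _).trans (abs_greenOp_le (hK s) x)
    have h2 := sq_le_sq' (by linarith [(_root_.abs_le.1 (hK' s x).1).1])
      (_root_.abs_le.1 (hK' s x).1).2
    unfold flux
    nlinarith [sq_nonneg K']
  -- A preliminary bound, growing linearly in time, from the boundedness of the flux. It only serves
  -- to give `flux_le` a finite `L`, hence some finite front speed.
  have hcrude : ∀ s ∈ Icc 0 T, Integrable (u s) ∧
      ∫ x, u s x ≤ (∫ x, u 0 x) + (K' ^ 2 + K) * T := fun s hs' => by
    refine integrable_of_intervalIntegral_le (hs.continuous_u s) (h0 s hs') fun x y hxy => ?_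
    have h1 := hs.conservation s hs' x y
    have hc : Continuous fun τ => flux b (u τ) (v τ) x - flux b (u τ) (v τ) y :=
      (hs.flux_time_continuous x).sub (hs.flux_time_continuous y)
    have h2 := intervalIntegral.integral_mono_on hs'.1 (hc.intervalIntegrable 0 s)
      (intervalIntegrable_const (μ := volume) (c := K' ^ 2 + K)) fun τ _ => by
        have := hF τ x
        have := flux_nonneg hb0 hb3 (u τ) (v τ) y
        linarith
    rw [intervalIntegral.integral_const, sub_zero, smul_eq_mul] at h2
    have h3 := hS x y hxy
    have h4 : s * (K' ^ 2 + K) ≤ T * (K' ^ 2 + K) :=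
      mul_le_mul_of_nonneg_right hs'.2 (by positivity)
    linarith
  set c : ℝ := 5 / 4 * ((∫ x, u 0 x) + (K' ^ 2 + K) * T) with hcdef
  have hc0 : 0 ≤ c := by
    have : 0 ≤ ∫ x, u 0 x := integral_nonneg (h0 0 ⟨le_rfl, hT⟩)
    positivity
  refine integrable_of_intervalIntegral_le (hs.continuous_u t) (h0 t ht) fun x y hxy => ?_
  -- Starting the front at `x - c * t` makes it arrive at `x`, so the mass on `[x,y]` is bounded by
  -- the initial mass on a larger interval. The size of `c` no longer matters.
  have h1 := (hs.mono ht.2).integral_front_le hb0 hb3 ht.1 (c := c) (fun s hs' z => by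
    have hs'' : s ∈ Icc 0 T := ⟨hs'.1, hs'.2.trans ht.2⟩
    exact flux_le hb0 hb3 (hs.hasDerivAt s) (hs.continuous_v s) (hs.abs_le hm hs'')
      (hcrude s hs'').1 (hcrude s hs'').2 z) (x - c * t) y
  rw [sub_add_cancel] at h1
  have : 0 ≤ c * t := mul_nonneg hc0 ht.1
  exact h1.trans (hS _ _ (by linarith))

/-- The mass to the right of `y + c t` is at most the initial mass to the right of `y`. -/
theorem integral_Ioi_le (hs : IsClassicalSolution b T u v w) (hb0 : 0 < b) (hb3 : b < 3)
    (hT : 0 ≤ T) (hm : ∀ x y, x ≤ y → 0 ≤ momentumIntegral (u 0) (v 0) x y)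
    (hi : Integrable (u 0)) {c : ℝ} (hc : 5 / 4 * ∫ x, u 0 x ≤ c) (y : ℝ) :
    ∫ z in Ioi (y + c * T), u T z ≤ ∫ z in Ioi y, u 0 z := by
  have hint := fun t ht => hs.integrable_and_integral_le hb0 hb3 hm hi (t := t) ht
  refine le_of_tendsto_of_tendsto'
    (intervalIntegral_tendsto_integral_Ioi _ (hint T ⟨hT, le_rfl⟩).1.integrableOn tendsto_id)
    (intervalIntegral_tendsto_integral_Ioi _ hi.integrableOn tendsto_id) fun Y => ?_
  refine hs.integral_front_le hb0 hb3 hT (fun s hs' x => ?_) y Y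
  refine (flux_le hb0 hb3 (hs.hasDerivAt s) (hs.continuous_v s) (hs.abs_le hm hs')
      (hint s hs').1 (hint s hs').2 x).trans ?_
  exact mul_le_mul_of_nonneg_right hc ((abs_nonneg _).trans (hs.abs_le hm hs' x))

end IsClassicalSolution

/-! ### Continuous representatives of `H²` functions -/

/-- Cauchy–Schwarz, as nonnegativity of the variance of `g` about its mean `m`. -/
theorem sq_intervalIntegral_le {g : ℝ → ℝ} {x y : ℝ} (hxy : x ≤ y)
    (hg : IntervalIntegrable g volume x y) (hg2 : IntervalIntegrable (fun z => g z ^ 2) volume x y) :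
    (∫ z in x..y, g z) ^ 2 ≤ (y - x) * ∫ z in x..y, g z ^ 2 := by
  rcases hxy.eq_or_lt with rfl | hlt
  · simp
  have hl : 0 < y - x := sub_pos.2 hlt
  set I := ∫ z in x..y, g z with hI
  set m := I / (y - x) with hm
  have h0 : 0 ≤ ∫ z in x..y, (g z - m) ^ 2 :=
    intervalIntegral.integral_nonneg hxy fun _ _ => sq_nonneg _
  have e : ∫ z in x..y, (g z - m) ^ 2 =
      (∫ z in x..y, g z ^ 2) - 2 * m * I + (y - x) * m ^ 2 := by
    have : ∀ z, (g z - m) ^ 2 = g z ^ 2 - 2 * m * g z + m ^ 2 := fun z => by ring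
    simp only [this]
    rw [intervalIntegral.integral_add (hg2.sub (hg.const_mul _)) intervalIntegrable_const,
      intervalIntegral.integral_sub hg2 (hg.const_mul _), intervalIntegral.integral_const_mul,
      intervalIntegral.integral_const, smul_eq_mul]
  have hmI : I = m * (y - x) := by rw [hm]; field_simp
  rw [e] at h0
  rw [hmI] at h0 ⊢
  nlinarith

/-- The embedding of `H¹` into `L^∞`: compare `f x` with `f z` and average over `z` in an interval
of length one. -/
theorem abs_le_sqrt_add_sqrt {f g : ℝ → ℝ} (hf : Continuous f) (hg : LocallyIntegrable g volume)
    (hfg : ∀ x y, f y - f x = ∫ z in x..y, g z) (hf2 : Integrable fun z => f z ^ 2)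
    (hg2 : Integrable fun z => g z ^ 2) (x : ℝ) :
    |f x| ≤ √(∫ z, f z ^ 2) + √(∫ z, g z ^ 2) := by
  have key : ∀ h : ℝ → ℝ, LocallyIntegrable h volume → (Integrable fun z => h z ^ 2) →
      ∫ z in x..x + 1, |h z| ≤ √(∫ z, h z ^ 2) := fun h hh hh2 => by
    refine Real.le_sqrt_of_sq_le ?_
    have h1 := sq_intervalIntegral_le (g := fun z => |h z|) (x := x) (y := x + 1) (by linarith)
      (hh.intervalIntegrable' _ _).abs (by simpa only [sq_abs] using hh2.intervalIntegrable)
    simp only [sq_abs, add_sub_cancel_left, one_mul] at h1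
    refine h1.trans ?_
    rw [intervalIntegral.integral_of_le (by linarith)]
    exact setIntegral_le_integral hh2 (Eventually.of_forall fun _ => sq_nonneg _)
  have h1 : ∀ z ∈ Icc x (x + 1), |f x| ≤ |f z| + ∫ z in x..x + 1, |g z| := fun z hz => by
    have h2 : |∫ z in x..z, g z| ≤ ∫ z in x..x + 1, |g z| :=
      (intervalIntegral.abs_integral_le_integral_abs hz.1).trans
        (intervalIntegral.integral_mono_interval le_rfl hz.1 hz.2
          (Eventually.of_forall fun _ => abs_nonneg _) (hg.intervalIntegrable' _ _).abs)
    rw [← hfg x z] at h2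
    have h3 := abs_sub_abs_le_abs_sub (f x) (f z)
    rw [abs_sub_comm] at h3
    linarith
  have h2 := intervalIntegral.integral_mono_on (a := x) (b := x + 1) (by linarith)
    (intervalIntegrable_const (μ := volume))
    ((hf.abs.intervalIntegrable _ _).add intervalIntegrable_const) h1
  simp only [intervalIntegral.integral_const, add_sub_cancel_left, one_smul] at h2
  rw [intervalIntegral.integral_add (hf.abs.intervalIntegrable _ _) intervalIntegrable_const] at h2
  simp only [intervalIntegral.integral_const, add_sub_cancel_left, one_smul] at h2
  exact h2.trans (add_le_add (key f hf.locallyIntegrable hf2) (key g hg hg2))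

theorem integral_sq_eq_norm_sq (f : Lp ℝ 2 (volume : Measure ℝ)) : ∫ x, f x ^ 2 = ‖f‖ ^ 2 := by
  rw [← real_inner_self_eq_norm_sq, L2.inner_def]
  refine integral_congr_ae (Eventually.of_forall fun x => ?_)
  simp [sq]

namespace H2

theorem memLp_fn (f : H2) : MemLp (H2.fn f) 2 volume := Lp.memLp _
theorem memLp_dx (f : H2) : MemLp (H2.dx f) 2 volume := Lp.memLp _
theorem memLp_dxx (f : H2) : MemLp (H2.dxx f) 2 volume := Lp.memLp _

theorem hasWeakDerivOn_fn (f : H2) : HasWeakDerivOn univ (H2.fn f) (H2.dx f) := f.2.1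
theorem hasWeakDerivOn_dx (f : H2) : HasWeakDerivOn univ (H2.dx f) (H2.dxx f) := f.2.2

theorem locallyIntegrable_dx (f : H2) : LocallyIntegrable (H2.dx f) volume :=
  locallyIntegrableOn_univ.1 f.2.1.locallyIntegrable_right

theorem locallyIntegrable_dxx (f : H2) : LocallyIntegrable (H2.dxx f) volume :=
  locallyIntegrableOn_univ.1 f.2.2.locallyIntegrable_right

/-- The continuous representative of the derivative. -/
def slope (f : H2) (x : ℝ) : ℝ :=
  (hasWeakDerivOn_dx f).exists_ae_eq_primitive.choose + ∫ t in (0 : ℝ)..x, H2.dxx f t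

/-- The continuous representative. -/
def rep (f : H2) (x : ℝ) : ℝ :=
  (hasWeakDerivOn_fn f).exists_ae_eq_primitive.choose + ∫ t in (0 : ℝ)..x, H2.dx f t

theorem dx_ae_eq_slope (f : H2) : H2.dx f =ᵐ[volume] slope f :=
  (hasWeakDerivOn_dx f).exists_ae_eq_primitive.choose_spec

theorem fn_ae_eq_rep (f : H2) : H2.fn f =ᵐ[volume] rep f :=
  (hasWeakDerivOn_fn f).exists_ae_eq_primitive.choose_spec

theorem continuous_slope (f : H2) : Continuous (slope f) :=
  continuous_const.add ((locallyIntegrable_dxx f).continuous_primitive 0)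

theorem continuous_rep (f : H2) : Continuous (rep f) :=
  continuous_const.add ((locallyIntegrable_dx f).continuous_primitive 0)

theorem slope_sub (f : H2) (x y : ℝ) : slope f y - slope f x = ∫ t in x..y, H2.dxx f t := by
  have h := locallyIntegrable_dxx f
  rw [← intervalIntegral.integral_interval_sub_left (h.intervalIntegrable' 0 y)
    (h.intervalIntegrable' 0 x)]
  unfold slope
  ring

theorem rep_sub (f : H2) (x y : ℝ) : rep f y - rep f x = ∫ t in x..y, H2.dx f t := by
  have h := locallyIntegrable_dx f
  rw [← intervalIntegral.integral_interval_sub_left (h.intervalIntegrable' 0 y)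
    (h.intervalIntegrable' 0 x)]
  unfold rep
  ring

theorem hasDerivAt_rep (f : H2) (x : ℝ) : HasDerivAt (rep f) (slope f x) x := by
  have e : rep f = fun y => rep f 0 + ∫ t in (0 : ℝ)..y, slope f t := funext fun y => by
    rw [← intervalIntegral.integral_congr_ae ((dx_ae_eq_slope f).mono fun _ h _ => h), ← rep_sub]
    ring
  rw [e]
  exact ((continuous_slope f).integral_hasStrictDerivAt 0 x).hasDerivAt.const_add _

theorem integral_dxx_sq_le (f : H2) : ∫ x, H2.dxx f x ^ 2 ≤ ‖f‖ ^ 2 := by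
  unfold H2.dxx
  rw [integral_sq_eq_norm_sq]
  exact pow_le_pow_left₀ (norm_nonneg _) (PiLp.norm_apply_le f.1 2) 2

theorem sqrt_integral_sq_le (f : H2) (i : Fin 3) : √(∫ x, f.1 i x ^ 2) ≤ ‖f‖ := by
  rw [integral_sq_eq_norm_sq, Real.sqrt_sq (norm_nonneg _)]
  exact PiLp.norm_apply_le f.1 i

theorem abs_slope_le (f : H2) (x : ℝ) : |slope f x| ≤ 2 * ‖f‖ := by
  have e : (fun z => H2.dx f z ^ 2) =ᵐ[volume] fun z => slope f z ^ 2 :=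
    (dx_ae_eq_slope f).mono fun z hz => by simp only [hz]
  have h := abs_le_sqrt_add_sqrt (continuous_slope f) (locallyIntegrable_dxx f) (slope_sub f)
    ((memLp_dx f).integrable_sq.congr e) (memLp_dxx f).integrable_sq x
  rw [← integral_congr_ae e] at h
  have h1 := sqrt_integral_sq_le f 1
  have h2 := sqrt_integral_sq_le f 2
  unfold H2.dx H2.dxx at h
  linarith

theorem abs_rep_le (f : H2) (x : ℝ) : |rep f x| ≤ 2 * ‖f‖ := by
  have e : (fun z => H2.fn f z ^ 2) =ᵐ[volume] fun z => rep f z ^ 2 :=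
    (fn_ae_eq_rep f).mono fun z hz => by simp only [hz]
  have h := abs_le_sqrt_add_sqrt (continuous_rep f) (locallyIntegrable_dx f) (rep_sub f)
    ((memLp_fn f).integrable_sq.congr e) (memLp_dx f).integrable_sq x
  rw [← integral_congr_ae e] at h
  have h1 := sqrt_integral_sq_le f 0
  have h2 := sqrt_integral_sq_le f 1
  unfold H2.fn H2.dx at h
  linarith

/-- The constant in `rep` is chosen separately for each function; linearity holds because continuous
functions that agree almost everywhere are equal. -/
theorem rep_sub_rep (f g : H2) (x : ℝ) : rep f x - rep g x = rep (f - g) x := by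
  have h : (fun x => rep f x - rep g x) =ᵐ[volume] rep (f - g) := by
    have h1 : H2.fn (f - g) =ᵐ[volume] H2.fn f - H2.fn g := Lp.coeFn_sub _ _
    filter_upwards [h1, fn_ae_eq_rep f, fn_ae_eq_rep g, fn_ae_eq_rep (f - g)] with x a1 a2 a3 a4
    rw [← a4, a1, Pi.sub_apply, a2, a3]
  exact congrFun ((((continuous_rep f).sub (continuous_rep g)).ae_eq_iff_eq volume
    (continuous_rep _)).1 h) x

theorem slope_sub_slope (f g : H2) (x : ℝ) : slope f x - slope g x = slope (f - g) x := by
  have h : (fun x => slope f x - slope g x) =ᵐ[volume] slope (f - g) := by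
    have h1 : H2.dx (f - g) =ᵐ[volume] H2.dx f - H2.dx g := Lp.coeFn_sub _ _
    filter_upwards [h1, dx_ae_eq_slope f, dx_ae_eq_slope g, dx_ae_eq_slope (f - g)]
      with x a1 a2 a3 a4
    rw [← a4, a1, Pi.sub_apply, a2, a3]
  exact congrFun ((((continuous_slope f).sub (continuous_slope g)).ae_eq_iff_eq volume
    (continuous_slope _)).1 h) x

theorem bFamilyFlux_ae_eq (b : ℝ) (f : H2) :
    bFamilyFlux b f =ᵐ[volume] flux b (rep f) (slope f) := by
  have e : greenOp (fun y => b / 2 * H2.fn f y ^ 2 + (3 - b) / 2 * H2.dx f y ^ 2) =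
      greenOp (source b (rep f) (slope f)) := funext fun x =>
    integral_congr_ae <| by
      filter_upwards [fn_ae_eq_rep f, dx_ae_eq_slope f] with y h1 h2
      simp only [source, h1, h2]
  filter_upwards [fn_ae_eq_rep f] with x hx
  simp only [bFamilyFlux, flux, hx, e]

theorem momentumIntegral_eq (f : H2) (x y : ℝ) :
    momentumIntegral (rep f) (slope f) x y = ∫ z in x..y, H2.momentum f z := by
  unfold momentumIntegral H2.momentum
  rw [slope_sub, ← intervalIntegral.integral_sub ((continuous_rep f).intervalIntegrable _ _)
    ((locallyIntegrable_dxx f).intervalIntegrable' _ _)]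
  exact intervalIntegral.integral_congr_ae ((fn_ae_eq_rep f).mono fun z hz _ => by rw [hz])

end H2

theorem continuous_uncurry_of_dist_le {E : Type*} [SeminormedAddCommGroup E] {f : ℝ → ℝ → ℝ}
    {U : ℝ → E} {C : ℝ} (hU : Continuous U) (hf : ∀ t, Continuous (f t))
    (h : ∀ t s x, |f t x - f s x| ≤ C * ‖U t - U s‖) : Continuous (Function.uncurry f) := by
  rw [continuous_iff_continuousAt]
  rintro ⟨t₀, x₀⟩
  have h1 : Tendsto (fun p : ℝ × ℝ => C * ‖U p.1 - U t₀‖) (𝓝 (t₀, x₀)) (𝓝 0) := by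
    have : Continuous fun p : ℝ × ℝ => C * ‖U p.1 - U t₀‖ := by fun_prop
    have := this.tendsto (t₀, x₀)
    simpa using this
  have h2 : Tendsto (fun p : ℝ × ℝ => f p.1 p.2 - f t₀ p.2) (𝓝 (t₀, x₀)) (𝓝 0) :=
    squeeze_zero_norm (fun p => h p.1 t₀ p.2) h1
  have h3 : Tendsto (fun p : ℝ × ℝ => f t₀ p.2) (𝓝 (t₀, x₀)) (𝓝 (f t₀ x₀)) :=
    ((hf t₀).comp continuous_snd).tendsto (t₀, x₀)
  have := h2.add h3
  simp only [sub_add_cancel, zero_add] at this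
  exact this

/-! ### From `H²` solutions to classical solutions -/

/-- After Fubini, the weak equation says that `g - f` is the weak derivative of the time-integrated
flux. Since everything is continuous, the flux is a genuine primitive of `g - f`. -/
theorem integral_sub_of_weak_conservation {F : ℝ → ℝ → ℝ} {f g : ℝ → ℝ} {t : ℝ}
    (hF : Continuous (Function.uncurry F)) (hf : Continuous f) (hg : Continuous g)
    (h : ∀ ψ : ℝ → ℝ, ContDiff ℝ ∞ ψ → HasCompactSupport ψ →
      ∫ x, f x * ψ x = (∫ x, g x * ψ x) + ∫ s in (0 : ℝ)..t, ∫ x, F s x * deriv ψ x) (x y : ℝ) :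
    (∫ z in x..y, f z) - ∫ z in x..y, g z = ∫ s in (0 : ℝ)..t, (F s x - F s y) := by
  set H : ℝ → ℝ := fun x => ∫ s in (0 : ℝ)..t, F s x with hH
  have hFx : ∀ x, Continuous fun s => F s x := fun x =>
    hF.comp (continuous_id.prodMk continuous_const)
  have hHc : Continuous H :=
    intervalIntegral.continuous_parametric_intervalIntegral_of_continuous'
      (f := fun x s => F s x) (hF.comp continuous_swap) 0 t
  have hw : HasWeakDerivOn univ H (g - f) := by
    refine ⟨locallyIntegrableOn_univ.2 hHc.locallyIntegrable,
      locallyIntegrableOn_univ.2 (hg.sub hf).locallyIntegrable, fun φ h1 h2 _ => ?_⟩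
    obtain ⟨R, hR, hs⟩ := exists_support_subset_Ioo h2
    have hd : Function.support (deriv φ) ⊆ Ioo (-R) R := (support_deriv_subset).trans hs
    have hdc : Continuous (deriv φ) := h1.continuous_deriv (by simp)
    have e1 : ∀ k : ℝ → ℝ, ∫ x, k x * deriv φ x = ∫ x in (-R)..R, k x * deriv φ x := fun k =>
      integral_eq_intervalIntegral_of_support
        ((Function.support_mul_subset_right k _).trans hd)
    have e2 : ∫ x, H x * deriv φ x = ∫ s in (0 : ℝ)..t, ∫ x, F s x * deriv φ x := by
      simp only [e1]
      have hc : Continuous (Function.uncurry fun s x => F s x * deriv φ x) :=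
        hF.mul (hdc.comp continuous_snd)
      rw [intervalIntegral_intervalIntegral_swap (F := fun s x => F s x * deriv φ x)]
      · simp only [hH, intervalIntegral.integral_mul_const]
      · exact (hc.continuousOn.integrableOn_compact
          (isCompact_uIcc.prod isCompact_uIcc)).mono_set
          (prod_mono uIoc_subset_uIcc uIoc_subset_uIcc)
    have hi : ∀ {k : ℝ → ℝ}, Continuous k → Integrable fun x => k x * φ x := fun hk =>
      integrable_mul_of_test (locallyIntegrableOn_univ.2 hk.locallyIntegrable) h1.continuous h2
    have e3 := h φ h1 h2
    simp only [Pi.sub_apply, sub_mul]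
    rw [e2, integral_sub (hi hg) (hi hf)]
    linarith
  obtain ⟨c, hc⟩ := hw.exists_ae_eq_primitive
  have hp : Continuous fun x => c + ∫ z in (0 : ℝ)..x, (g - f) z :=
    continuous_const.add ((hg.sub hf).locallyIntegrable.continuous_primitive 0)
  have he := fun x => congrFun ((hHc.ae_eq_iff_eq volume hp).1 hc) x
  rw [intervalIntegral.integral_sub ((hFx x).intervalIntegrable _ _)
    ((hFx y).intervalIntegrable _ _)]
  change _ = H x - H y
  have hgf : Continuous (g - f) := hg.sub hf
  rw [he x, he y, ← intervalIntegral.integral_sub (hf.intervalIntegrable _ _)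
    (hg.intervalIntegrable _ _)]
  have e4 := intervalIntegral.integral_interval_sub_left (hgf.intervalIntegrable (μ := volume) 0 y)
    (hgf.intervalIntegrable 0 x)
  have e5 : ∫ z in x..y, (f z - g z) = -∫ z in x..y, (g - f) z := by
    rw [← intervalIntegral.integral_neg]
    simp
  rw [e5, ← e4]
  ring

/-- Time is clamped to `[0,T]`. -/
def clampTime (T : ℝ) (t : ℝ) : ℝ := max 0 (min t T)

theorem clampTime_of_mem {T t : ℝ} (ht : t ∈ Icc 0 T) : clampTime T t = t := by
  simp [clampTime, min_eq_left ht.2, max_eq_right ht.1]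

theorem clampTime_mem {T : ℝ} (hT : 0 ≤ T) (t : ℝ) : clampTime T t ∈ Icc 0 T :=
  ⟨le_max_left _ _, max_le hT (min_le_right _ _)⟩

theorem continuous_clampTime (T : ℝ) : Continuous (clampTime T) := by
  unfold clampTime
  fun_prop

theorem IsGlobalSolution.isClassicalSolution {b : ℝ} {u : ℝ → H2} (hu : IsGlobalSolution b u)
    {T : ℝ} (hT : 0 ≤ T) :
    IsClassicalSolution b T (fun t => H2.rep (u (clampTime T t)))
      (fun t => H2.slope (u (clampTime T t))) (fun t => H2.dxx (u (clampTime T t))) := by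
  set U : ℝ → H2 := fun t => u (clampTime T t) with hU
  have hUc : Continuous U := hu.continuousOn.comp_continuous (continuous_clampTime T)
    fun t => (clampTime_mem hT t).1
  obtain ⟨M, hM⟩ := isCompact_Icc.exists_bound_of_continuousOn
    (hu.continuousOn.mono (fun _ ht => ht.1 : Icc 0 T ⊆ Ici 0))
  have hM' : ∀ t, ‖U t‖ ≤ M := fun t => hM _ (clampTime_mem hT t)
  have hM0 : 0 ≤ M := (norm_nonneg _).trans (hM' 0)
  -- For `T = -1` the time interval is empty and the conservation law is vacuous. This makes
  -- continuity of the flux available for the proof of the law itself.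
  have kin : IsClassicalSolution b (-1) (fun t => H2.rep (U t)) (fun t => H2.slope (U t))
      (fun t => H2.dxx (U t)) :=
    { continuous_left := continuous_uncurry_of_dist_le (C := 2) hUc
        (fun t => H2.continuous_rep _) fun t s x => by
          rw [H2.rep_sub_rep]
          exact H2.abs_rep_le _ _
      continuous_right := continuous_uncurry_of_dist_le (C := 2) hUc
        (fun t => H2.continuous_slope _) fun t s x => by
          rw [H2.slope_sub_slope]
          exact H2.abs_slope_le _ _
      hasDerivAt := fun t x => H2.hasDerivAt_rep _ x
      exists_bound := ⟨2 * M, by positivity, fun t x =>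
        ⟨(H2.abs_rep_le _ _).trans (by linarith [hM' t]),
          (H2.abs_slope_le _ _).trans (by linarith [hM' t])⟩⟩
      integrable_sq := fun t => (H2.memLp_dxx _).integrable_sq
      exists_integral_sq_le := ⟨M ^ 2, fun t => (H2.integral_dxx_sq_le _).trans
        (pow_le_pow_left₀ (norm_nonneg _) (hM' t) 2)⟩
      sub_sq_le := fun t x y hxy => by
        rw [H2.slope_sub]
        exact sq_intervalIntegral_le hxy ((H2.locallyIntegrable_dxx _).intervalIntegrable' _ _)
          (H2.memLp_dxx _).integrable_sq.intervalIntegrable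
      conservation := fun t ht => absurd (ht.1.trans ht.2) (by norm_num) }
  refine { kin with conservation := fun t ht x y => ?_ }
  refine integral_sub_of_weak_conservation
    (F := fun s => flux b (H2.rep (U s)) (H2.slope (U s))) kin.continuous_flux
    (H2.continuous_rep _) (H2.continuous_rep _) (fun ψ h1 h2 => ?_) x y
  have e : ∀ f : H2, ∫ x, H2.rep f x * ψ x = ∫ x, H2.fn f x * ψ x := fun f =>
    integral_congr_ae ((H2.fn_ae_eq_rep f).mono fun x hx => by simp only [hx])
  have e2 : ∫ s in (0 : ℝ)..t, ∫ x, flux b (H2.rep (U s)) (H2.slope (U s)) x * deriv ψ x =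
      ∫ s in (0 : ℝ)..t, ∫ x, bFamilyFlux b (u s) x * deriv ψ x := by
    refine intervalIntegral.integral_congr fun s hs => ?_
    rw [uIcc_of_le ht.1] at hs
    have hUs : U s = u s := by rw [hU]; simp only [clampTime_of_mem ⟨hs.1, hs.2.trans ht.2⟩]
    simp only [hUs]
    exact integral_congr_ae ((H2.bFamilyFlux_ae_eq b (u s)).symm.mono fun x hx => by
      simp only [hx])
  rw [e, e, e2, clampTime_of_mem ht, clampTime_of_mem ⟨le_rfl, hT⟩]
  exact hu.weak_eq ψ h1 h2 t ht.1

/-- The equation is invariant under `(x, u) ↦ (-x, -u)`. -/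
theorem IsClassicalSolution.reflect {b T : ℝ} {u v w : ℝ → ℝ → ℝ}
    (hs : IsClassicalSolution b T u v w) :
    IsClassicalSolution b T (fun t x => -u t (-x)) (fun t x => v t (-x))
      (fun t x => w t (-x)) where
  continuous_left := (hs.continuous_left.comp (continuous_fst.prodMk continuous_snd.neg)).neg
  continuous_right := hs.continuous_right.comp (continuous_fst.prodMk continuous_snd.neg)
  hasDerivAt t x :=
    (((hs.hasDerivAt t (-x)).comp x (hasDerivAt_neg x)).neg).congr_deriv (by ring)
  exists_bound := by
    obtain ⟨K, h0, hK⟩ := hs.exists_bound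
    exact ⟨K, h0, fun t x => ⟨by rw [abs_neg]; exact (hK t (-x)).1, (hK t (-x)).2⟩⟩
  integrable_sq t := (hs.integrable_sq t).comp_neg
  exists_integral_sq_le := by
    obtain ⟨K, hK⟩ := hs.exists_integral_sq_le
    exact ⟨K, fun t => by rw [integral_neg_eq_self fun x => w t x ^ 2]; exact hK t⟩
  sub_sq_le t x y hxy := by
    have := hs.sub_sq_le t (-y) (-x) (by linarith)
    rw [intervalIntegral.integral_comp_neg fun x => w t x ^ 2]
    linarith
  conservation t ht x y := by
    have h := hs.conservation t ht (-y) (-x)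
    have e : ∀ s z, flux b (fun x => -u s (-x)) (fun x => v s (-x)) z =
        flux b (u s) (v s) (-z) := fun s z => by
      have : source b (fun x => -u s (-x)) (fun x => v s (-x)) =
          fun y => source b (u s) (v s) (-y) := by
        funext y
        simp [source]
      unfold flux
      rw [this, greenOp_comp_neg]
      ring
    simp only [e]
    rw [intervalIntegral.integral_neg, intervalIntegral.integral_neg,
      intervalIntegral.integral_comp_neg fun x => u t x,
      intervalIntegral.integral_comp_neg fun x => u 0 x]
    have e2 : ∫ s in (0 : ℝ)..t, (flux b (u s) (v s) (-x) - flux b (u s) (v s) (-y)) =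
        -∫ s in (0 : ℝ)..t, (flux b (u s) (v s) (-y) - flux b (u s) (v s) (-x)) := by
      rw [← intervalIntegral.integral_neg]
      simp
    rw [e2, ← h]
    ring

/-! ### Decay of the norms -/

/-- Interpolation: `|f|^p ≤ D^(p-1) |f|`, and the integral of `|f|` contributes the last factor `D`.
-/
theorem eLpNorm_le_of_ae_le_of_lintegral_le {α : Type*} [MeasurableSpace α] {μ : Measure α}
    {f : α → ℝ} {D p : ℝ≥0∞} (hp : 1 ≤ p) (h1 : ∀ᵐ x ∂μ, ‖f x‖ₑ ≤ D)
    (h2 : ∫⁻ x, ‖f x‖ₑ ∂μ ≤ D) : eLpNorm f p μ ≤ D := by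
  rcases eq_or_ne p ⊤ with rfl | hp'
  · rw [eLpNorm_exponent_top]
    exact eLpNormEssSup_le_of_ae_enorm_bound h1
  have hr : 1 ≤ p.toReal := by
    rw [← ENNReal.toReal_one]
    exact ENNReal.toReal_mono hp' hp
  have hr0 : 0 < p.toReal := zero_lt_one.trans_le hr
  rw [eLpNorm_eq_lintegral_rpow_enorm_toReal (zero_lt_one.trans_le hp).ne' hp', one_div]
  refine ENNReal.rpow_inv_le_iff hr0 |>.2 ?_
  have hsplit : ∀ a : ℝ≥0∞, a ^ p.toReal = a ^ (p.toReal - 1) * a := fun a => by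
    conv_rhs => rw [← ENNReal.rpow_one a, ← ENNReal.rpow_mul, one_mul]
    rw [← ENNReal.rpow_add_of_nonneg _ _ (by linarith) zero_le_one]
    simp
  calc ∫⁻ x, ‖f x‖ₑ ^ p.toReal ∂μ ≤ ∫⁻ x, D ^ (p.toReal - 1) * ‖f x‖ₑ ∂μ := by
        refine lintegral_mono_ae (h1.mono fun x hx => ?_)
        rw [hsplit]
        gcongr
    _ ≤ D ^ (p.toReal - 1) * D := by
        by_cases hD : D = ⊤
        · rcases eq_or_ne (p.toReal - 1) 0 with h0 | h0
          · simpa [h0] using h2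
          · have : D ^ (p.toReal - 1) * D = ⊤ := by
              rw [hD, ENNReal.top_rpow_of_pos (lt_of_le_of_ne (by linarith) h0.symm)]
              simp
            rw [this]
            exact le_top
        · rw [lintegral_const_mul' _ _ (ENNReal.rpow_ne_top_of_nonneg (by linarith) hD)]
          gcongr
    _ = D ^ p.toReal := (hsplit D).symm

theorem IsClassicalSolution.eLpNorm_Ioi_le {b T : ℝ} {u v w : ℝ → ℝ → ℝ}
    (hs : IsClassicalSolution b T u v w) (hb0 : 0 < b) (hb3 : b < 3) (hT : 0 ≤ T)
    (hm : ∀ x y, x ≤ y → 0 ≤ momentumIntegral (u 0) (v 0) x y) (hi : Integrable (u 0)) {c : ℝ}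
    (hc : 5 / 4 * ∫ x, u 0 x ≤ c) {p : ℝ≥0∞} (hp : 1 ≤ p) :
    eLpNorm (u T) p (volume.restrict (Ioi (2 * c * T))) ≤
      ENNReal.ofReal (∫ x in Ioi (c * T), u 0 x) := by
  have hTm : T ∈ Icc 0 T := ⟨hT, le_rfl⟩
  have hv := hs.abs_le hm hTm
  have hu0 : ∀ x, 0 ≤ u T x := fun x => (abs_nonneg _).trans (hv x)
  have hint := (hs.integrable_and_integral_le hb0 hb3 hm hi hTm).1
  -- The front starts at `c * T`, which itself recedes to infinity, and arrives at `2 * c * T`.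
  have hle := hs.integral_Ioi_le hb0 hb3 hT hm hi hc (c * T)
  rw [← two_mul, ← mul_assoc] at hle
  refine eLpNorm_le_of_ae_le_of_lintegral_le hp ?_ ?_
  · refine (ae_restrict_iff' measurableSet_Ioi).2 (Eventually.of_forall fun x hx => ?_)
    rw [Real.enorm_of_nonneg (hu0 x)]
    refine ENNReal.ofReal_le_ofReal ?_
    refine (le_integral_Ioi_of_abs_deriv_le (hs.hasDerivAt T) (hs.continuous_v T) hv hint x).trans
      (le_trans ?_ hle)
    exact setIntegral_mono_set hint.integrableOn (Eventually.of_forall hu0)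
      (Ioi_subset_Ioi (mem_Ioi.1 hx).le).eventuallyLE
  · rw [← ofReal_integral_norm_eq_lintegral_enorm hint.integrableOn]
    simp only [Real.norm_of_nonneg (hu0 _)]
    exact ENNReal.ofReal_le_ofReal hle

/-- On every interval `∫ u = ∫ m + [u_x]`, which is at most `L + 2K`; and `u ≥ 0`. -/
theorem IsClassicalSolution.integrable_zero {b T : ℝ} {u v w : ℝ → ℝ → ℝ}
    (hs : IsClassicalSolution b T u v w) (hT : 0 ≤ T) {L : ℝ}
    (hm : ∀ x y, x ≤ y → 0 ≤ momentumIntegral (u 0) (v 0) x y)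
    (hL : ∀ x y, x ≤ y → momentumIntegral (u 0) (v 0) x y ≤ L) : Integrable (u 0) := by
  obtain ⟨K, _, hK⟩ := hs.exists_bound
  have hv := hs.abs_le hm (t := 0) ⟨le_rfl, hT⟩
  refine (integrable_of_intervalIntegral_le (L := L + 2 * K) (hs.continuous_u 0)
    (fun x => (abs_nonneg _).trans (hv x)) fun x y hxy => ?_).1
  have h1 := hL x y hxy
  unfold momentumIntegral at h1
  linarith [(_root_.abs_le.1 (hK 0 y).2).2, (_root_.abs_le.1 (hK 0 x).2).1]

theorem tendsto_ofReal_integral_Ioi {f : ℝ → ℝ} (hf : Integrable f) {c : ℝ} (hc : 0 < c) :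
    Tendsto (fun t : ℝ => ENNReal.ofReal (∫ x in Ioi (c * t), f x)) atTop (𝓝 0) := by
  have h1 : Tendsto (fun a : ℝ => ∫ x in Ioi a, f x) atTop (𝓝 0) := by
    have h2 := (intervalIntegral_tendsto_integral_Ioi 0 (hf.integrableOn (s := Ioi 0))
      tendsto_id).const_sub (∫ x in Ioi 0, f x)
    rw [sub_self] at h2
    refine h2.congr fun a => ?_
    rw [id, ← intervalIntegral.integral_Ioi_sub_Ioi' hf.integrableOn hf.integrableOn]
    ring
  have h3 := (ENNReal.tendsto_ofReal h1).comp (tendsto_id.const_mul_atTop hc)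
  simpa using! h3

theorem eW1pNorm_fn_le (f : H2) {U : Set ℝ} {p : ℝ≥0∞} (hf : ∀ x, |H2.slope f x| ≤ |H2.rep f x|) :
    eW1pNorm p U (H2.fn f) ≤ 2 * eLpNorm (H2.rep f) p (volume.restrict U) := by
  refine (iInf₂_le (H2.dx f) ((H2.hasWeakDerivOn_fn f).mono (subset_univ U))).trans ?_
  rw [eLpNorm_congr_ae (ae_restrict_of_ae (H2.fn_ae_eq_rep f)), two_mul]
  gcongr
  refine eLpNorm_mono_ae (ae_restrict_of_ae ?_)
  filter_upwards [H2.dx_ae_eq_slope f] with x hx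
  rw [hx]
  exact hf x

theorem abs_intervalIntegral_momentum_le {f : H2} (hm : Integrable (H2.momentum f) volume)
    (x y : ℝ) (hxy : x ≤ y) :
    |∫ z in x..y, H2.momentum f z| ≤ ∫ z, |H2.momentum f z| := by
  refine (intervalIntegral.abs_integral_le_integral_abs hxy).trans ?_
  rw [intervalIntegral.integral_of_le hxy]
  exact setIntegral_le_integral hm.abs (Eventually.of_forall fun _ => abs_nonneg _)

end

/-! ### The two decay statements -/

theorem theorem1p5 (b : ℝ) (hb0 : 0 < b) (hb3 : b < 3) (u : ℝ → H2)
    (hu : IsGlobalSolution b u) (hm : Integrable (H2.momentum (u 0)) volume) :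
    ((∀ᵐ x ∂volume, 0 ≤ H2.momentum (u 0) x) →
      ∃ σ : ℝ, 0 < σ ∧ ∀ p : ℝ≥0∞, 1 ≤ p →
        Tendsto (fun t : ℝ => eW1pNorm p (Ioi (σ * t)) (H2.fn (u t))) atTop (𝓝 0)) ∧
    ((∀ᵐ x ∂volume, H2.momentum (u 0) x ≤ 0) →
      ∃ σ : ℝ, 0 < σ ∧ ∀ p : ℝ≥0∞, 1 ≤ p →
        Tendsto (fun t : ℝ => eW1pNorm p (Iio (-(σ * t))) (H2.fn (u t))) atTop (𝓝 0)) := by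
  have hmi := abs_intervalIntegral_momentum_le hm
  have hcl : ∀ {T : ℝ}, 0 ≤ T → clampTime T 0 = 0 := fun hT => clampTime_of_mem ⟨le_rfl, hT⟩
  have hclT : ∀ {T : ℝ}, 0 ≤ T → clampTime T T = T := fun hT => clampTime_of_mem ⟨hT, le_rfl⟩
  constructor
  · intro hpos
    have hM : ∀ x y, x ≤ y → 0 ≤ momentumIntegral (H2.rep (u 0)) (H2.slope (u 0)) x y :=
      fun x y hxy => by
        rw [H2.momentumIntegral_eq]
        exact intervalIntegral.integral_nonneg_of_ae hxy hpos
    have hi : Integrable (H2.rep (u 0)) := by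
      have := (hu.isClassicalSolution le_rfl).integrable_zero le_rfl
        (L := ∫ z, |H2.momentum (u 0) z|)
      simp only [hcl le_rfl] at this
      refine this hM fun x y hxy => ?_
      rw [H2.momentumIntegral_eq]
      exact (le_abs_self _).trans (hmi x y hxy)
    -- The added 1 keeps the speed positive even for zero mass, so that `c * t → ∞`.
    set c : ℝ := |5 / 4 * ∫ x, H2.rep (u 0) x| + 1 with hc
    have hc0 : 0 < c := by positivity
    refine ⟨2 * c, by positivity, fun p hp => ?_⟩
    have hlim := ENNReal.Tendsto.const_mul (a := 2) (tendsto_ofReal_integral_Ioi hi hc0)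
      (Or.inr (by simp))
    rw [mul_zero] at hlim
    refine tendsto_of_tendsto_of_tendsto_of_le_of_le' tendsto_const_nhds hlim
      (Eventually.of_forall fun _ => zero_le) ?_
    filter_upwards [eventually_ge_atTop 0] with T hT
    have hs := hu.isClassicalSolution hT
    have h1 := hs.eLpNorm_Ioi_le hb0 hb3 hT (c := c) (p := p)
    have h2 := fun hm => hs.abs_le hm (t := T) ⟨hT, le_rfl⟩
    simp only [hcl hT, hclT hT] at h1 h2
    refine (eW1pNorm_fn_le (u T) fun x => (h2 hM x).trans (le_abs_self _)).trans ?_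
    gcongr
    exact h1 hM hi (by linarith [le_abs_self (5 / 4 * ∫ x, H2.rep (u 0) x)]) hp
  · intro hneg
    -- The reflected solution has momentum `-m(-x) ≥ 0`, and the argument of part (i) applies to it.
    have hMr : ∀ x y, momentumIntegral (fun x => -H2.rep (u 0) (-x))
        (fun x => H2.slope (u 0) (-x)) x y = -∫ z in (-y)..(-x), H2.momentum (u 0) z :=
      fun x y => by
        rw [← H2.momentumIntegral_eq]
        unfold momentumIntegral
        rw [intervalIntegral.integral_neg,
          intervalIntegral.integral_comp_neg fun x => H2.rep (u 0) x]
        ring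
    have hM : ∀ x y, x ≤ y → 0 ≤ momentumIntegral (fun x => -H2.rep (u 0) (-x))
        (fun x => H2.slope (u 0) (-x)) x y := fun x y hxy => by
      rw [hMr, ← intervalIntegral.integral_neg]
      exact intervalIntegral.integral_nonneg_of_ae (by linarith)
        (hneg.mono fun z hz => neg_nonneg.2 hz)
    have hi : Integrable fun x => -H2.rep (u 0) (-x) := by
      have := (hu.isClassicalSolution le_rfl).reflect.integrable_zero le_rfl
        (L := ∫ z, |H2.momentum (u 0) z|)
      simp only [hcl le_rfl] at this
      refine this hM fun x y hxy => ?_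
      rw [hMr]
      exact (neg_le_abs _).trans (hmi _ _ (by linarith))
    set c : ℝ := |5 / 4 * ∫ x, -H2.rep (u 0) (-x)| + 1 with hc
    have hc0 : 0 < c := by positivity
    refine ⟨2 * c, by positivity, fun p hp => ?_⟩
    have hlim := ENNReal.Tendsto.const_mul (a := 2) (tendsto_ofReal_integral_Ioi hi hc0)
      (Or.inr (by simp))
    rw [mul_zero] at hlim
    refine tendsto_of_tendsto_of_tendsto_of_le_of_le' tendsto_const_nhds hlim
      (Eventually.of_forall fun _ => zero_le) ?_
    filter_upwards [eventually_ge_atTop 0] with T hT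
    have hs := (hu.isClassicalSolution hT).reflect
    have h1 := hs.eLpNorm_Ioi_le hb0 hb3 hT (c := c) (p := p)
    have h2 := fun hm => hs.abs_le hm (t := T) ⟨hT, le_rfl⟩
    simp only [hcl hT, hclT hT] at h1 h2
    refine (eW1pNorm_fn_le (u T) fun x => ?_).trans ?_
    · have := h2 hM (-x)
      rw [neg_neg] at this
      exact this.trans (neg_le_abs _)
    · have h3 := h1 hM hi (by linarith [le_abs_self (5 / 4 * ∫ x, -H2.rep (u 0) (-x))]) hp
      have hmp : MeasurePreserving (fun x : ℝ => -x) (volume.restrict (Ioi (2 * c * T)))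
          (volume.restrict (Iio (-(2 * c * T)))) := by
        have := (Measure.measurePreserving_neg (volume : Measure ℝ)).restrict_preimage
          (s := Iio (-(2 * c * T))) measurableSet_Iio
        simpa using this
      have h4 := eLpNorm_comp_measurePreserving (p := p)
        (H2.continuous_rep (u T)).aestronglyMeasurable hmp
      have h5 : eLpNorm (fun x => -H2.rep (u T) (-x)) p (volume.restrict (Ioi (2 * c * T))) =
          eLpNorm (H2.rep (u T)) p (volume.restrict (Iio (-(2 * c * T)))) := by
        rw [← h4]
        exact eLpNorm_neg _ _ _
      rw [← h5]
      gcongr
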